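/- For a prime $p$, let $\mathbb{Z}_p^m$ carry the Haar measure of total mass $1$. A random polynomial of degree $n$ over $\mathbb{Z}_p$ is $f=c_nx^n+\cdots+c_0$ with $(c_0,\dots,c_n)\in\mathbb{Z}_p^{n+1}$ distributed according to this measure; a random monic polynomial of degree $n$ is $f=x^n+a_{n-1}x^{n-1}+\cdots+a_0$ with $(a_0,\dots,a_{n-1})\in\mathbb{Z}_p^{n}$ so distributed. For $0\le r\le n$ let $\rho^*(n,r)$ (resp. $\alpha^*(n,r)$, resp. $\beta^*(n,r)$) be the probability that a random polynomial of degree $n$ (resp. a random monic polynomial of degree $n$, resp. a random monic polynomial of degree $n$ conditioned to reduce to $x^n$ modulo $p$) has exactly $r$ distinct roots in $\mathbb{Q}_p$. For $0\le d\le n$ put $\rho(n,d)=\sum_{r=0}^n\binom rd\rho^*(n,r)$, the expected number of $d$-element sets of $\mathbb{Q}_p$-roots of a random polynomial of degree $n$, and let $\alpha(n,d)$ (resp. $\beta(n,d)$) be the expected number of $d$-element sets of $\mathbb{Q}_p$-roots of a random monic polynomial of degree $n$ (resp. one conditioned to reduce to $x^n$ modulo $p$). All these quantities depend on $p$, and $p\to\infty$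 means through the primes. **Proposition 1.2.** (a) Let $0\le d\le n$ be integers and $k=\min(d+1,n)$. Then $$\lim_{p\to\infty}\alpha(n,d)=\lim_{p\to\infty}\rho(n,d)=\lim_{p\to\infty}p^{\binom k2}\beta(n,d)=\frac1{d!}.$$ (b) Let $0\le r\le n$ be integers. Then $$\lim_{p\to\infty}\rho^*(n,r)=\lim_{p\to\infty}\alpha^*(n,r)=\sum_{d=0}^n(-1)^{d-r}\binom dr\frac1{d!}=\frac1{r!}\sum_{d=0}^{n-r}(-1)^d\frac1{d!}.$$ Hence, for every fixed $r\ge0$, $$\lim_{n\to\infty}\lim_{p\to\infty}\rho^*(n,r)=\lim_{n\to\infty}\lim_{p\to\infty}\alpha^*(n,r)=\frac1{r!}e^{-1}.$$ (c) Let $0\le r\le n$ be integers with $r\ne n-1$, and let $k=\min(r+1,n)$. Then $$\lim_{p\to\infty}p^{\binom k2}\beta^*(n,r)=\frac1{r!}.$$ -/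

import Mathlib

open MeasureTheory Filter Topology
open scoped ENNReal

namespace PadicRoots

noncomputable section

/-- `ℤ_[p]` carries its Borel σ-algebra. -/
instance instMeasurableSpacePadicInt (p : ℕ) [Fact p.Prime] : MeasurableSpace ℤ_[p] :=
  borel ℤ_[p]

instance instBorelSpacePadicInt (p : ℕ) [Fact p.Prime] : BorelSpace ℤ_[p] := ⟨rfl⟩

instance instFactPrimes (p : Nat.Primes) : Fact (p : ℕ).Prime := ⟨p.2⟩

/-- The filter "`p → ∞` through the prime numbers". -/
def primesAtTop : Filter Nat.Primes := comap (fun p : Nat.Primes => (p : ℕ)) atTop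

/-- The Haar measure on `ℤ_p` with total mass `1`. -/
def haarZp (p : ℕ) [Fact p.Prime] : Measure ℤ_[p] :=
  Measure.addHaarMeasure (⊤ : TopologicalSpace.PositiveCompacts ℤ_[p])

instance instIsAddHaarMeasureHaarZp (p : ℕ) [Fact p.Prime] : (haarZp p).IsAddHaarMeasure := by
  unfold haarZp; infer_instance

instance instIsProbabilityMeasureHaarZp (p : ℕ) [Fact p.Prime] :
    IsProbabilityMeasure (haarZp p) :=
  ⟨Measure.addHaarMeasure_self (K₀ := (⊤ : TopologicalSpace.PositiveCompacts ℤ_[p]))⟩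

/-- The Haar measure on `ℤ_p ^ m` with total mass `1`: the product of the normalised Haar measures
on the factors. -/
def haarZpPow (p : ℕ) [Fact p.Prime] (m : ℕ) : Measure (Fin m → ℤ_[p]) :=
  Measure.pi fun _ => haarZp p

instance instIsAddHaarMeasureHaarZpPow (p : ℕ) [Fact p.Prime] (m : ℕ) :
    (haarZpPow p m).IsAddHaarMeasure := by
  unfold haarZpPow; infer_instance

instance instIsProbabilityMeasureHaarZpPow (p : ℕ) [Fact p.Prime] (m : ℕ) :
    IsProbabilityMeasure (haarZpPow p m) := by
  unfold haarZpPow; infer_instance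

/-- The polynomial `c_n x^n + ⋯ + c_1 x + c_0` with coefficient vector `c ∈ ℤ_p ^ (n+1)`. -/
def generalPoly (p : ℕ) [Fact p.Prime] (n : ℕ) (c : Fin (n + 1) → ℤ_[p]) : Polynomial ℤ_[p] :=
  ∑ i : Fin (n + 1), Polynomial.C (c i) * Polynomial.X ^ (i : ℕ)

/-- The monic polynomial `x^n + a_{n-1} x^{n-1} + ⋯ + a_0` with coefficient vector
`a ∈ ℤ_p ^ n`. -/
def monicPoly (p : ℕ) [Fact p.Prime] (n : ℕ) (a : Fin n → ℤ_[p]) : Polynomial ℤ_[p] :=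
  Polynomial.X ^ n + ∑ i : Fin n, Polynomial.C (a i) * Polynomial.X ^ (i : ℕ)

/-- The set of roots of `f` in `ℚ_p` (all of `ℚ_p` if `f = 0`). -/
def padicRoots (p : ℕ) [Fact p.Prime] (f : Polynomial ℤ_[p]) : Set ℚ_[p] :=
  {x | Polynomial.aeval x f = 0}

/-- The family of the sets of exactly `d` distinct roots of `f` in `ℚ_p`. -/
def rootDSets (p : ℕ) [Fact p.Prime] (d : ℕ) (f : Polynomial ℤ_[p]) : Set (Finset ℚ_[p]) :=
  {s | s.card = d ∧ (s : Set ℚ_[p]) ⊆ padicRoots p f}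

/-- The distribution of the coefficients of a random monic polynomial of degree `n` over `ℤ_p`
that reduces to `x^n` modulo `p`: the Haar measure on `ℤ_p ^ n` conditioned on this event. -/
def haarReducing (p : ℕ) [Fact p.Prime] (n : ℕ) : Measure (Fin n → ℤ_[p]) :=
  ProbabilityTheory.cond (haarZpPow p n)
    {a | (monicPoly p n a).map (PadicInt.toZMod (p := p)) = Polynomial.X ^ n}

/-- `ρ*(n,r;p)`: the probability that a random polynomial of degree `n` over `ℤ_p` has exactly `r`
roots in `ℚ_p`. The coefficient vectors whose leading entry is `0` form a null set. -/
def rhoStar (p : ℕ) [Fact p.Prime] (n r : ℕ) : ℝ :=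
  (haarZpPow p (n + 1) {c | (padicRoots p (generalPoly p n c)).encard = r}).toReal

/-- `α*(n,r;p)`: the probability that a random monic polynomial of degree `n` over `ℤ_p` has
exactly `r` roots in `ℚ_p`. -/
def alphaStar (p : ℕ) [Fact p.Prime] (n r : ℕ) : ℝ :=
  (haarZpPow p n {a | (padicRoots p (monicPoly p n a)).encard = r}).toReal

/-- `β*(n,r;p)`: the probability that a random monic polynomial of degree `n` over `ℤ_p` that
reduces to `x^n` modulo `p` has exactly `r` roots in `ℚ_p`. -/
def betaStar (p : ℕ) [Fact p.Prime] (n r : ℕ) : ℝ :=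
  (haarReducing p n {a | (padicRoots p (monicPoly p n a)).encard = r}).toReal

/-- `ρ(n,d;p) = ∑_{r=0}^n (r choose d) ρ*(n,r;p)`, the expected number of `d`-sets of `ℚ_p`-roots
of a random polynomial of degree `n` over `ℤ_p`. -/
def rho (p : ℕ) [Fact p.Prime] (n d : ℕ) : ℝ :=
  ∑ r ∈ Finset.range (n + 1), (r.choose d : ℝ) * rhoStar p n r

/-- `α(n,d;p)`: the expected number of `d`-sets of `ℚ_p`-roots of a random monic polynomial of
degree `n` over `ℤ_p`. -/
def alpha (p : ℕ) [Fact p.Prime] (n d : ℕ) : ℝ :=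
  (∫⁻ a, ((rootDSets p d (monicPoly p n a)).encard : ℝ≥0∞) ∂haarZpPow p n).toReal

/-- `β(n,d;p)`: the expected number of `d`-sets of `ℚ_p`-roots of a random monic polynomial of
degree `n` over `ℤ_p` that reduces to `x^n` modulo `p`. -/
def beta (p : ℕ) [Fact p.Prime] (n d : ℕ) : ℝ :=
  (∫⁻ a, ((rootDSets p d (monicPoly p n a)).encard : ℝ≥0∞) ∂haarReducing p n).toReal

end

end PadicRoots

/-! Modulo `p` the coefficients become independent and uniform in `𝔽_p`, and all limits can be read
off from the reduction with error `O(1/p)`. A multiple `𝔽_p`-root occurs with probability at most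
`1/p`; otherwise Hensel's lemma (`encard_roots_eq_numRoots`) identifies the roots in `ℤ_p` with
those in `𝔽_p`. Roots in `ℚ_p` outside `ℤ_p` require `p` to divide the leading coefficient, again an
event of probability `1/p`. By interpolation, `d` given points of `𝔽_p` are all roots with
probability `p ^ (-d)`, so the expected number of `d`-sets of roots is `(p choose d) / p ^ d`, which
tends to `1 / d!` (`abs_integral_rootWeight_sub_le`). Binomial inversion (`exactWeight_eq_sum`)
turns these expectations into probabilities of exactly `r` roots.

For `β`, let `f` be monic with reduction `x ^ n` and with `d` roots. All roots are divisible by `p`,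
so `f` is a product of `d` factors `x - r` with `p ∣ r` and a cofactor reducing to `x ^ (n - d)`.
This forces `p ^ (k - i) ∣ a_i` for `k = min (d + 1) n` (`coeffDvd_of_roots`), an event of
conditional probability `p ^ (-(k choose 2))` (`restrict_haarReducing`). On it, `p ^ (-k) f(p x)` is
integral, and its reduction is a uniform polynomial of degree less than `k`, or a uniform monic one
if `k = n`: the earlier cases again. -/

namespace PadicRoots

open Polynomial

/-! ### Fibres of homomorphisms onto finite groups -/

/-- An invariant probability measure gives the same mass to all fibres of a homomorphism onto a
finite group. -/
lemma measureReal_fiber {G H : Type*} [AddCommGroup G] [MeasurableSpace G] [MeasurableAdd G]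
    (μ : Measure G) [IsProbabilityMeasure μ] [μ.IsAddLeftInvariant] [AddCommGroup H] [Finite H]
    (φ : G →+ H) (hφ : Function.Surjective φ) (hm : MeasurableSet (φ ⁻¹' {0})) (h : H) :
    μ.real (φ ⁻¹' {h}) = (Nat.card H : ℝ)⁻¹ := by
  have hker : (φ.ker : Set G) = φ ⁻¹' {0} := by
    ext x; simp [AddMonoidHom.mem_ker]
  have hidx : φ.ker.index = Nat.card H := by
    rw [AddSubgroup.index_ker, AddMonoidHom.range_eq_top.2 hφ]
    exact Nat.card_congr AddSubgroup.topEquiv.toEquiv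
  have hH : Nat.card H ≠ 0 := Nat.card_pos.ne'
  have : φ.ker.FiniteIndex := ⟨by rw [hidx]; exact hH⟩
  have key := AddSubgroup.index_mul_measure φ.ker (by rw [hker]; exact hm) μ
  rw [hidx, hker, measure_univ] at key
  obtain ⟨x, rfl⟩ := hφ h
  have htr : φ ⁻¹' {φ x} = (fun y => -x + y) ⁻¹' (φ ⁻¹' {0}) := by
    ext y
    simp only [Set.mem_preimage, Set.mem_singleton_iff, map_add, map_neg]
    rw [neg_add_eq_zero, eq_comm]
  have : μ (φ ⁻¹' {φ x}) = μ (φ ⁻¹' {0}) := by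
    rw [htr, measure_preimage_add]
  rw [measureReal_def, this]
  have h2 := congrArg ENNReal.toReal key
  rw [ENNReal.toReal_mul] at h2
  simp only [ENNReal.toReal_natCast, ENNReal.toReal_one] at h2
  exact eq_inv_of_mul_eq_one_right h2

/-! ### Reduction modulo `p` of a random coefficient vector. -/

section Reduction

variable (p : ℕ) [Fact p.Prime]

lemma toZMod_eq_zero_iff_dvd (x : ℤ_[p]) : PadicInt.toZMod x = 0 ↔ (p : ℤ_[p]) ∣ x := by
  rw [← RingHom.mem_ker, PadicInt.ker_toZMod, PadicInt.maximalIdeal_eq_span_p,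
    Ideal.mem_span_singleton]

lemma toZMod_eq_iff_norm_sub_lt (x y : ℤ_[p]) :
    PadicInt.toZMod x = PadicInt.toZMod y ↔ ‖x - y‖ < 1 := by
  rw [← sub_eq_zero, ← map_sub, toZMod_eq_zero_iff_dvd, PadicInt.norm_lt_one_iff_dvd]

lemma toZMod_surjective : Function.Surjective (PadicInt.toZMod (p := p)) :=
  ZMod.ringHom_surjective _

lemma measurableSet_toZMod_eq (c : ZMod p) :
    MeasurableSet {x : ℤ_[p] | PadicInt.toZMod x = c} := by
  obtain ⟨y, rfl⟩ := toZMod_surjective p c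
  have : {x : ℤ_[p] | PadicInt.toZMod x = PadicInt.toZMod y} = Metric.ball y 1 := by
    ext x
    simp [toZMod_eq_iff_norm_sub_lt, dist_eq_norm]
  rw [this]
  exact Metric.isOpen_ball.measurableSet

/-- Only finitely many reductions exist and each fibre is a product of balls, so every event that
depends on the reduction alone is measurable. -/
lemma measurableSet_toZMod_mem (N : ℕ) (S : Set (Fin N → ZMod p)) :
    MeasurableSet {b : Fin N → ℤ_[p] | (fun i => PadicInt.toZMod (b i)) ∈ S} := by
  have : {b : Fin N → ℤ_[p] | (fun i => PadicInt.toZMod (b i)) ∈ S} =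
      ⋃ v ∈ S, ⋂ i, (fun b : Fin N → ℤ_[p] => b i) ⁻¹' {x | PadicInt.toZMod x = v i} := by
    ext b
    simp only [Set.mem_ofPred_eq, Set.mem_iUnion, Set.mem_iInter, Set.mem_preimage, exists_prop]
    constructor
    · intro h
      exact ⟨_, h, fun i => rfl⟩
    · rintro ⟨v, hv, h⟩
      rwa [funext h]
  rw [this]
  refine MeasurableSet.biUnion S.toFinite.countable fun v _ => MeasurableSet.iInter fun i => ?_
  exact measurable_pi_apply i (measurableSet_toZMod_eq p (v i))

/-- The reduction modulo `p` of the polynomial of degree less than `m` with coefficient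
vector `b`. -/
noncomputable def redHom (N m : ℕ) : (Fin N → ℤ_[p]) →+ (ZMod p)[X] :=
  -- The cut-off `m` is separate from the number `N` of coordinates because, after rescaling,
  -- coefficients in high degrees vanish modulo `p` although they remain random in `ℤ_p`.
  AddMonoidHom.mk' (fun b => ∑ i : Fin N,
    if (i : ℕ) < m then C (PadicInt.toZMod (b i)) * X ^ (i : ℕ) else 0) (by
      intro a b
      rw [← Finset.sum_add_distrib]
      refine Finset.sum_congr rfl fun i _ => ?_
      split_ifs <;> simp [add_mul])

variable {p}

lemma redHom_apply {N m : ℕ} (b : Fin N → ℤ_[p]) : redHom p N m b = ∑ i : Fin N,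
    if (i : ℕ) < m then C (PadicInt.toZMod (b i)) * X ^ (i : ℕ) else 0 := rfl

lemma coeff_redHom {N m : ℕ} (b : Fin N → ℤ_[p]) (i : Fin N) (hi : (i : ℕ) < m) :
    (redHom p N m b).coeff i = PadicInt.toZMod (b i) := by
  rw [redHom_apply, finsetSum_coeff, Finset.sum_eq_single i]
  · simp [hi]
  · intro j _ hj
    split_ifs
    · rw [coeff_C_mul, coeff_X_pow, if_neg (fun h => hj (Fin.ext h.symm)), mul_zero]
    · simp
  · simp

lemma degree_redHom_lt {N m : ℕ} (b : Fin N → ℤ_[p]) : (redHom p N m b).degree < m := by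
  rw [redHom_apply, ← mem_degreeLT]
  refine Submodule.sum_mem _ fun i _ => mem_degreeLT.2 ?_
  split_ifs with h
  · exact (degree_C_mul_X_pow_le _ _).trans_lt (by exact_mod_cast h)
  · simp

lemma exists_redHom_eq {N m : ℕ} (hm : m ≤ N) (q : (ZMod p)[X]) (hq : q.degree < m) :
    ∃ b, redHom p N m b = q := by
  choose f hf using toZMod_surjective p
  refine ⟨fun i => f (q.coeff i), ?_⟩
  ext j
  by_cases hj : j < m
  · have := coeff_redHom (m := m) (fun i : Fin N => f (q.coeff i)) ⟨j, hj.trans_le hm⟩ hj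
    simpa [hf] using this
  · rw [coeff_eq_zero_of_degree_lt, coeff_eq_zero_of_degree_lt]
    · exact hq.trans_le (by exact_mod_cast not_lt.1 hj)
    · exact (degree_redHom_lt _).trans_le (by exact_mod_cast not_lt.1 hj)

lemma measurableSet_redHom_preimage {N m : ℕ} (S : Set (ZMod p)[X]) :
    MeasurableSet (redHom p N m ⁻¹' S) :=
  measurableSet_toZMod_mem p N {v | (∑ i : Fin N,
    if (i : ℕ) < m then C (v i) * X ^ (i : ℕ) else 0) ∈ S}

/-- A homomorphism onto a finite group that only depends on the reduction takes each value with
the same probability. -/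
lemma measureReal_redHom_fiber {N m : ℕ} (hm : m ≤ N) {H : Type*} [AddCommGroup H] [Finite H]
    (L : (ZMod p)[X] →+ H) (hL : ∀ h, ∃ q : (ZMod p)[X], q.degree < m ∧ L q = h) (h : H) :
    (haarZpPow p N).real {b | L (redHom p N m b) = h} = (Nat.card H : ℝ)⁻¹ := by
  refine measureReal_fiber (haarZpPow p N) (L.comp (redHom p N m)) ?_ ?_ h
  · intro h
    obtain ⟨q, hq, rfl⟩ := hL h
    obtain ⟨b, rfl⟩ := exists_redHom_eq hm q hq
    exact ⟨b, rfl⟩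
  · exact measurableSet_redHom_preimage (L ⁻¹' {0})

/-- The probability that the random polynomial `A + redHom b` vanishes on a given set. -/
lemma measureReal_vanish {N m : ℕ} (hm : m ≤ N) (A : (ZMod p)[X]) (s : Finset (ZMod p))
    (hs : s.card ≤ m) :
    (haarZpPow p N).real {b | ∀ a ∈ s, (A + redHom p N m b).eval a = 0} =
      ((p : ℝ) ^ s.card)⁻¹ := by
  let L : (ZMod p)[X] →+ (s → ZMod p) :=
    AddMonoidHom.mk' (fun q a => q.eval (a : ZMod p)) (by intro a b; ext; simp)
  have key := measureReal_redHom_fiber (N := N) hm L (fun h => ?_) (fun a => - A.eval (a : ZMod p))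
  · rw [Nat.card_fun, Nat.card_zmod, Nat.card_eq_fintype_card, Fintype.card_coe] at key
    push_cast at key
    rw [← key]
    congr 1
    ext b
    simp only [Set.mem_ofPred_eq, eval_add, funext_iff, Subtype.forall]
    refine forall₂_congr fun a _ => ?_
    change _ ↔ eval a _ = _
    rw [add_comm, add_eq_zero_iff_eq_neg]
  -- Evaluation on `s` is onto already in degree less than `s.card ≤ m`, by interpolation.
  · refine ⟨Lagrange.interpolate s.attach (fun a => (a : ZMod p)) h, ?_, ?_⟩
    · refine (Lagrange.degree_interpolate_lt _ Subtype.val_injective.injOn).trans_le ?_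
      rw [Finset.card_attach]
      exact_mod_cast hs
    · ext a
      exact Lagrange.eval_interpolate_at_node _ Subtype.val_injective.injOn (Finset.mem_attach _ a)

/-- The probability that the random polynomial `redHom b` is zero. -/
lemma measureReal_redHom_eq_zero {N m : ℕ} (hm : m ≤ N) :
    (haarZpPow p N).real {b | redHom p N m b = 0} = ((p : ℝ) ^ m)⁻¹ := by
  let L : (ZMod p)[X] →+ (Fin m → ZMod p) :=
    AddMonoidHom.mk' (fun q i => q.coeff i) (by intro a b; ext; simp)
  have key := measureReal_redHom_fiber (N := N) hm L (fun h => ?_) 0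
  · rw [Nat.card_fun, Nat.card_zmod, Nat.card_eq_fintype_card, Fintype.card_fin] at key
    push_cast at key
    rw [← key]
    congr 1
    ext b
    simp only [Set.mem_ofPred_eq]
    constructor
    · intro h; rw [h, map_zero]
    · intro h
      ext j
      by_cases hj : j < m
      · exact congrFun h ⟨j, hj⟩
      · rw [coeff_zero, coeff_eq_zero_of_degree_lt]
        exact (degree_redHom_lt _).trans_le (by exact_mod_cast not_lt.1 hj)
  · refine ⟨∑ i : Fin m, C (h i) * X ^ (i : ℕ), degree_sum_fin_lt _, ?_⟩
    ext i
    change (∑ i : Fin m, C (h i) * X ^ (i : ℕ)).coeff i = _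
    rw [finsetSum_coeff, Finset.sum_eq_single i]
    · simp
    · intro j _ hj
      rw [coeff_C_mul, coeff_X_pow, if_neg (fun h => hj (Fin.ext h.symm)), mul_zero]
    · simp

/-- The probability that the random polynomial `A + redHom b` has a multiple root at `a`. -/
lemma measureReal_double_root {N m : ℕ} (hm : m ≤ N) (h2 : 2 ≤ m) (A : (ZMod p)[X]) (a : ZMod p) :
    (haarZpPow p N).real {b | (A + redHom p N m b).eval a = 0 ∧
      (A + redHom p N m b).derivative.eval a = 0} = ((p : ℝ) ^ 2)⁻¹ := by
  let L : (ZMod p)[X] →+ (ZMod p × ZMod p) :=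
    AddMonoidHom.mk' (fun q => (q.eval a, q.derivative.eval a)) (by intro a b; simp)
  have key := measureReal_redHom_fiber (N := N) hm L (fun h => ?_)
    (- A.eval a, - A.derivative.eval a)
  · rw [Nat.card_prod, Nat.card_zmod] at key
    push_cast at key
    rw [sq, ← key]
    congr 1
    ext b
    simp only [Set.mem_ofPred_eq, eval_add, derivative_add]
    change _ ↔ (eval a _, eval a _) = _
    rw [Prod.mk.injEq, add_comm, add_eq_zero_iff_eq_neg, add_comm (eval a (derivative A)),
      add_eq_zero_iff_eq_neg]
  -- The linear polynomial with prescribed value and derivative at `a`; it is available because `2 ≤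
  -- m`.
  · refine ⟨C h.2 * X + C (h.1 - h.2 * a), ?_, ?_⟩
    · refine degree_linear_le.trans_lt ?_
      exact_mod_cast h2
    · change (eval a _, eval a _) = _
      simp

end Reduction

/-! ### Polynomials over `𝔽_p` without multiple `𝔽_p`-roots -/

section Finite

variable {p : ℕ} [Fact p.Prime]

/-- All roots of `g` in `𝔽_p` are simple. -/
def HasSimpleRoots (g : (ZMod p)[X]) : Prop :=
  ∀ a, g.eval a = 0 → g.derivative.eval a ≠ 0

/-- The number of roots of `g` in `𝔽_p`. -/
noncomputable def numRoots (g : (ZMod p)[X]) : ℕ :=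
  (Finset.univ.filter fun a => g.eval a = 0).card

lemma HasSimpleRoots.ne_zero {g : (ZMod p)[X]} (hg : HasSimpleRoots g) : g ≠ 0 := by
  rintro rfl
  exact hg 0 (by simp) (by simp)

lemma numRoots_le_natDegree {g : (ZMod p)[X]} (hg : g ≠ 0) : numRoots g ≤ g.natDegree := by
  classical
  refine le_trans ?_ ((Multiset.toFinset_card_le _).trans (card_roots' g))
  refine Finset.card_le_card fun a ha => ?_
  rw [Multiset.mem_toFinset, mem_roots hg]
  exact (Finset.mem_filter.1 ha).2

lemma numRoots_le_prime (g : (ZMod p)[X]) : numRoots g ≤ p := by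
  refine (Finset.card_filter_le _ _).trans ?_
  rw [Finset.card_univ, ZMod.card]

open Classical in
-- Expansion into indicators, which makes linearity of expectation applicable.
lemma choose_numRoots (g : (ZMod p)[X]) (d : ℕ) :
    ((numRoots g).choose d : ℝ) = ∑ s ∈ Finset.powersetCard d (Finset.univ : Finset (ZMod p)),
      if ∀ a ∈ s, g.eval a = 0 then (1 : ℝ) else 0 := by
  rw [numRoots, ← Finset.card_powersetCard, Finset.sum_boole]
  congr 2
  ext s
  simp only [Finset.mem_powersetCard, Finset.mem_filter, true_and, Finset.subset_iff,
    Finset.mem_univ]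
  tauto

open Classical in
/-- The number of `d`-sets of `𝔽_p`-roots of `g`, set to `0` if `g` has a multiple root. -/
noncomputable def rootWeight (d : ℕ) (g : (ZMod p)[X]) : ℝ :=
  if HasSimpleRoots g then ((numRoots g).choose d : ℝ) else 0

lemma rootWeight_nonneg (d : ℕ) (g : (ZMod p)[X]) : 0 ≤ rootWeight d g := by
  unfold rootWeight; split_ifs <;> positivity

lemma rootWeight_le {d n : ℕ} {g : (ZMod p)[X]} (hg : g.natDegree ≤ n) :
    rootWeight d g ≤ n.choose d := by
  unfold rootWeight
  split_ifs with h
  · exact_mod_cast Nat.choose_le_choose d ((numRoots_le_natDegree h.ne_zero).trans hg)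
  · positivity

lemma measurable_comp_redHom {N m : ℕ} {β : Type*} [MeasurableSpace β] (F : (ZMod p)[X] → β) :
    Measurable fun b => F (redHom p N m b) :=
  fun S _ => measurableSet_redHom_preimage (F ⁻¹' S)

lemma integrable_comp_redHom {N m : ℕ} (F : (ZMod p)[X] → ℝ) (K : ℝ) (hK : ∀ g, |F g| ≤ K) :
    Integrable (fun b => F (redHom p N m b)) (haarZpPow p N) :=
  Integrable.of_bound (measurable_comp_redHom F).aestronglyMeasurable K
    (Eventually.of_forall fun _ => hK _)

open Classical in
-- Each of the `p.choose d` subsets consists of roots with probability exactly `p ^ (-d)`.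
-- Polynomials with multiple roots are still counted, and the zero polynomial counts with `p` roots.
lemma integral_choose_numRoots {N m d : ℕ} (hm : m ≤ N) (hd : d ≤ m) (A : (ZMod p)[X]) :
    ∫ b, ((numRoots (A + redHom p N m b)).choose d : ℝ) ∂haarZpPow p N =
      (p.choose d : ℝ) / (p : ℝ) ^ d := by
  simp_rw [choose_numRoots]
  rw [integral_finsetSum]
  · have : ∀ s ∈ Finset.powersetCard d (Finset.univ : Finset (ZMod p)),
        ∫ b, (if ∀ a ∈ s, (A + redHom p N m b).eval a = 0 then (1 : ℝ) else 0) ∂haarZpPow p N =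
          ((p : ℝ) ^ d)⁻¹ := by
      intro s hs
      have hs' := (Finset.mem_powersetCard.1 hs).2
      rw [← hs', ← measureReal_vanish hm A s (hs'.trans_le hd), ← integral_indicator_one]
      · simp [Set.indicator_apply]
      · exact measurableSet_redHom_preimage {q | ∀ a ∈ s, (A + q).eval a = 0}
    rw [Finset.sum_congr rfl this, Finset.sum_const, Finset.card_powersetCard, Finset.card_univ,
      ZMod.card, nsmul_eq_mul, div_eq_mul_inv]
  · intro s _
    refine integrable_comp_redHom
      (fun q => if ∀ a ∈ s, (A + q).eval a = 0 then (1 : ℝ) else 0) 1 fun g => ?_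
    split_ifs <;> simp

lemma abs_rootWeight_le (d : ℕ) (g : (ZMod p)[X]) : |rootWeight d g| ≤ p.choose d := by
  rw [abs_of_nonneg (rootWeight_nonneg d g)]
  unfold rootWeight
  split_ifs
  · exact_mod_cast Nat.choose_le_choose d (numRoots_le_prime g)
  · positivity

open Classical in
/-- The expected number of `d`-sets of roots, restricted to polynomials with simple roots. -/
lemma abs_integral_rootWeight_sub_le {N m d n : ℕ} (hm : m ≤ N) (hd : d ≤ m) (A : (ZMod p)[X])
    (hdeg : ∀ b, (A + redHom p N m b).natDegree ≤ n)
    (hsimple : (haarZpPow p N).real {b | ¬ HasSimpleRoots (A + redHom p N m b)} ≤ 1 / p)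
    (hzero : (haarZpPow p N).real {b | A + redHom p N m b = 0} * (p : ℝ) ^ d ≤ 1 / p) :
    |∫ b, rootWeight d (A + redHom p N m b) ∂haarZpPow p N - (p.choose d : ℝ) / (p : ℝ) ^ d| ≤
      (n.choose d + 1) / p := by
  have hm1 : MeasurableSet {b | ¬ HasSimpleRoots (A + redHom p N m b)} :=
    measurableSet_redHom_preimage {q | ¬ HasSimpleRoots (A + q)}
  have hm2 : MeasurableSet {b | A + redHom p N m b = 0} :=
    measurableSet_redHom_preimage {q | A + q = 0}
  have hiX : Integrable (fun b => ((numRoots (A + redHom p N m b)).choose d : ℝ))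
      (haarZpPow p N) :=
    integrable_comp_redHom (fun q => ((numRoots (A + q)).choose d : ℝ)) (p.choose d) fun g => by
      rw [abs_of_nonneg (by positivity)]
      exact_mod_cast Nat.choose_le_choose d (numRoots_le_prime _)
  have hiW : Integrable (fun b => rootWeight d (A + redHom p N m b)) (haarZpPow p N) :=
    integrable_comp_redHom (fun q => rootWeight d (A + q)) (p.choose d) fun g =>
      abs_rootWeight_le d _
  rw [← integral_choose_numRoots hm hd A, abs_sub_comm, ← integral_sub hiX hiW, abs_of_nonneg]
  -- The integrand vanishes where the roots are simple. Elsewhere the degree bounds it by `n.choose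
  -- d`, except at the zero polynomial, whose `p` roots cost up to `p ^ d`; `hzero` absorbs that.
  · have hbound : ∫ b, (((numRoots (A + redHom p N m b)).choose d : ℝ) -
          rootWeight d (A + redHom p N m b)) ∂haarZpPow p N ≤
        ∫ b, ({b | ¬ HasSimpleRoots (A + redHom p N m b)}.indicator
            (fun _ => (n.choose d : ℝ)) b +
          {b | A + redHom p N m b = 0}.indicator (fun _ => (p : ℝ) ^ d) b) ∂haarZpPow p N := by
      refine integral_mono (hiX.sub hiW) ?_ fun b => ?_
      · exact ((integrable_const _).indicator hm1).add ((integrable_const _).indicator hm2)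
      · simp only [Set.indicator_apply, Set.mem_ofPred_eq, rootWeight]
        by_cases hs : HasSimpleRoots (A + redHom p N m b)
        · simp [hs, hs.ne_zero]
        · by_cases hz : A + redHom p N m b = 0
          · have h1 : (numRoots (A + redHom p N m b)).choose d ≤ p ^ d :=
              (Nat.choose_le_choose d (numRoots_le_prime _)).trans (Nat.choose_le_pow p d)
            have h2 : ((numRoots (A + redHom p N m b)).choose d : ℝ) ≤ (p : ℝ) ^ d := by
              exact_mod_cast h1
            rw [if_neg hs, if_pos hs, if_pos hz, sub_zero]
            have : (0 : ℝ) ≤ n.choose d := by positivity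
            linarith
          · have h1 := Nat.choose_le_choose d ((numRoots_le_natDegree hz).trans (hdeg b))
            simp only [hs, hz, if_false, sub_zero, not_false_eq_true, if_true, add_zero]
            exact_mod_cast h1
    refine hbound.trans ?_
    rw [integral_add ((integrable_const _).indicator hm1) ((integrable_const _).indicator hm2),
      integral_indicator_const _ hm1, integral_indicator_const _ hm2, add_div, smul_eq_mul,
      smul_eq_mul]
    refine add_le_add ?_ hzero
    rw [mul_comm, div_eq_mul_one_div]
    exact mul_le_mul_of_nonneg_left hsimple (by positivity)
  · refine integral_nonneg fun b => ?_
    simp only [Pi.zero_apply, rootWeight]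
    split_ifs
    · simp
    · simp

/-- Union bound: `p` candidate points, each a multiple root with probability `p ^ (-2)`. -/
lemma measureReal_not_hasSimpleRoots_of_two_le {N m : ℕ} (hm : m ≤ N) (h2 : 2 ≤ m)
    (A : (ZMod p)[X]) :
    (haarZpPow p N).real {b | ¬ HasSimpleRoots (A + redHom p N m b)} ≤ 1 / p := by
  have hsub : {b | ¬ HasSimpleRoots (A + redHom p N m b)} ⊆
      ⋃ a ∈ (Finset.univ : Finset (ZMod p)), {b | (A + redHom p N m b).eval a = 0 ∧
        (A + redHom p N m b).derivative.eval a = 0} := by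
    intro b hb
    simp only [Set.mem_ofPred_eq, HasSimpleRoots, not_forall, not_not] at hb
    obtain ⟨a, h1, h2⟩ := hb
    simp only [Set.mem_iUnion]
    exact ⟨a, Finset.mem_univ a, h1, h2⟩
  refine (measureReal_mono hsub (measure_ne_top _ _)).trans ((measureReal_biUnion_finset_le _ _).trans ?_)
  simp_rw [measureReal_double_root hm h2]
  rw [Finset.sum_const, Finset.card_univ, ZMod.card, nsmul_eq_mul]
  have : (p : ℝ) ≠ 0 := by exact_mod_cast (Fact.out : p.Prime).ne_zero
  field_simp
  rfl

lemma eq_C_of_degree_lt_one {q : (ZMod p)[X]} (hq : q.degree < (1 : ℕ)) : q = C (q.coeff 0) :=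
  eq_C_of_degree_le_zero (Nat.WithBot.lt_one_iff_le_zero.1 hq)

lemma measureReal_not_hasSimpleRoots_redHom {N m : ℕ} (hm : m ≤ N) (h1 : 1 ≤ m) :
    (haarZpPow p N).real {b | ¬ HasSimpleRoots (0 + redHom p N m b)} ≤ 1 / p := by
  rcases h1.eq_or_lt with rfl | h2
  -- For `m = 1` the polynomial is constant, so a root forces it to be zero.
  · rw [one_div, ← pow_one (p : ℝ), ← measureReal_redHom_eq_zero hm]
    refine measureReal_mono fun b hb => ?_
    simp only [Set.mem_ofPred_eq, HasSimpleRoots, not_forall, not_not, zero_add] at hb ⊢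
    obtain ⟨a, h1, -⟩ := hb
    have hC := eq_C_of_degree_lt_one (degree_redHom_lt (p := p) (m := 1) b)
    rw [hC, eval_C] at h1
    rw [hC, h1, C_0]
  · exact measureReal_not_hasSimpleRoots_of_two_le hm h2 0

lemma measureReal_not_hasSimpleRoots_monic (N : ℕ) :
    (haarZpPow p N).real {b | ¬ HasSimpleRoots (X ^ N + redHom p N N b)} ≤ 1 / p := by
  rcases le_or_gt 2 N with h2 | h2
  · exact measureReal_not_hasSimpleRoots_of_two_le le_rfl h2 _
  -- A monic polynomial of degree `0` has no root, and one of degree `1` has derivative `1`.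
  · have : {b | ¬ HasSimpleRoots (X ^ N + redHom p N N b)} = ∅ := by
      ext b
      simp only [Set.mem_ofPred_eq, Set.mem_empty_iff_false, iff_false, not_not]
      interval_cases N
      · intro a ha
        simp [redHom_apply] at ha
      · intro a _
        rw [eq_C_of_degree_lt_one (degree_redHom_lt (p := p) (m := 1) b)]
        simp
    rw [this, measureReal_empty]
    positivity

lemma monic_X_pow_add_redHom {N : ℕ} (b : Fin N → ℤ_[p]) :
    (X ^ N + redHom p N N b).Monic :=
  monic_X_pow_add (degree_redHom_lt b)

lemma natDegree_X_pow_add_redHom {N : ℕ} (b : Fin N → ℤ_[p]) :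
    (X ^ N + redHom p N N b).natDegree = N := by
  have h := degree_redHom_lt (p := p) (m := N) b
  rw [natDegree_eq_of_degree_eq_some]
  rw [degree_add_eq_left_of_degree_lt] <;> rw [degree_X_pow]
  exact h

lemma abs_integral_rootWeight_monic_sub_le {N d : ℕ} (hd : d ≤ N) :
    |∫ b, rootWeight d (X ^ N + redHom p N N b) ∂haarZpPow p N -
      (p.choose d : ℝ) / (p : ℝ) ^ d| ≤ (N.choose d + 1) / p := by
  refine abs_integral_rootWeight_sub_le le_rfl hd _ (fun b => (natDegree_X_pow_add_redHom b).le)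
    (measureReal_not_hasSimpleRoots_monic N) ?_
  have : {b | X ^ N + redHom p N N b = 0} = ∅ := by
    ext b
    simpa using (monic_X_pow_add_redHom b).ne_zero
  rw [this, measureReal_empty, zero_mul]
  positivity

/-- Strictness of `d < m` makes the zero polynomial negligible: it has probability `p ^ (-m)` and at
most `p ^ d` sets of roots. -/
lemma abs_integral_rootWeight_redHom_sub_le {N m d : ℕ} (hm : m ≤ N) (hd : d < m) :
    |∫ b, rootWeight d (0 + redHom p N m b) ∂haarZpPow p N -
      (p.choose d : ℝ) / (p : ℝ) ^ d| ≤ ((m - 1).choose d + 1) / p := by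
  refine abs_integral_rootWeight_sub_le hm hd.le _ (fun b => ?_)
    (measureReal_not_hasSimpleRoots_redHom hm (by omega)) ?_
  · rw [zero_add]
    refine natDegree_le_of_degree_le ?_
    have h := degree_redHom_lt (p := p) (m := m) b
    obtain ⟨k, rfl⟩ : ∃ k, m = k + 1 := ⟨m - 1, by omega⟩
    exact Order.le_of_lt_succ h
  · simp_rw [zero_add]
    rw [measureReal_redHom_eq_zero hm]
    have h0 : (0 : ℝ) < p := by exact_mod_cast (Fact.out : p.Prime).pos
    have h1 : (1 : ℝ) ≤ p := by exact_mod_cast (Fact.out : p.Prime).one_lt.le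
    rw [inv_mul_eq_div, div_le_div_iff₀ (by positivity) h0, one_mul, ← pow_succ]
    exact pow_le_pow_right₀ h1 hd

end Finite

/-! ### Comparison of integrals and measures -/

section Compare

variable {Ω : Type*} [MeasurableSpace Ω] (μ : Measure Ω) [IsProbabilityMeasure μ]

/-- Two functions with values in `[0, K]` that agree off a set `B` have integrals that differ by
at most `K μ(B)`; the first function need not be measurable. -/
lemma abs_toReal_lintegral_sub_integral_le {Y : Ω → ℝ≥0∞} {W : Ω → ℝ} {B : Set Ω} {K : ℝ}
    (hB : MeasurableSet B) (hW : Measurable W) (hW0 : ∀ ω, 0 ≤ W ω) (hWK : ∀ ω, W ω ≤ K)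
    (hYK : ∀ ω, Y ω ≤ ENNReal.ofReal K) (hYW : ∀ ω ∉ B, Y ω = ENNReal.ofReal (W ω)) :
    |(∫⁻ ω, Y ω ∂μ).toReal - ∫ ω, W ω ∂μ| ≤ K * μ.real B := by
  obtain ⟨ω₀⟩ : Nonempty Ω := μ.nonempty_of_neZero
  have hK : 0 ≤ K := (hW0 ω₀).trans (hWK ω₀)
  have hWY : ∫⁻ ω, ENNReal.ofReal (W ω) ∂μ ≤ ∫⁻ ω, Y ω ∂μ + ENNReal.ofReal K * μ B := by
    -- Additivity needs measurability of only one summand, here the indicator, so nothing is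
    -- required of `Y`.
    rw [← lintegral_indicator_const hB, ← lintegral_add_right _ (measurable_const.indicator hB)]
    refine lintegral_mono fun ω => ?_
    by_cases h : ω ∈ B
    · simp only [h, Set.indicator_of_mem]
      exact (ENNReal.ofReal_le_ofReal (hWK ω)).trans le_add_self
    · simp [h, hYW ω h]
  have hYW' : ∫⁻ ω, Y ω ∂μ ≤ ∫⁻ ω, ENNReal.ofReal (W ω) ∂μ + ENNReal.ofReal K * μ B := by
    rw [← lintegral_indicator_const hB, ← lintegral_add_right _ (measurable_const.indicator hB)]
    refine lintegral_mono fun ω => ?_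
    by_cases h : ω ∈ B
    · simp only [h, Set.indicator_of_mem]
      exact (hYK ω).trans le_add_self
    · simp [h, hYW ω h]
  have hfin : ∀ Z : Ω → ℝ≥0∞, (∀ ω, Z ω ≤ ENNReal.ofReal K) → ∫⁻ ω, Z ω ∂μ ≠ ∞ := by
    intro Z hZ
    refine ((lintegral_mono hZ).trans_lt ?_).ne
    simp
  have hY := hfin Y hYK
  have hWf := hfin _ fun ω => ENNReal.ofReal_le_ofReal (hWK ω)
  have hBf : ENNReal.ofReal K * μ B ≠ ∞ := ENNReal.mul_ne_top (by simp) (by simp)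
  rw [integral_eq_lintegral_of_nonneg_ae (Eventually.of_forall hW0) hW.aestronglyMeasurable]
  have h1 := ENNReal.toReal_mono (ENNReal.add_ne_top.2 ⟨hY, hBf⟩) hWY
  have h2 := ENNReal.toReal_mono (ENNReal.add_ne_top.2 ⟨hWf, hBf⟩) hYW'
  rw [ENNReal.toReal_add hY hBf, ENNReal.toReal_mul, ENNReal.toReal_ofReal hK] at h1
  rw [ENNReal.toReal_add hWf hBf, ENNReal.toReal_mul, ENNReal.toReal_ofReal hK] at h2
  rw [abs_le, measureReal_def]
  constructor <;> linarith

lemma abs_measureReal_sub_le {S T B : Set Ω} (h : ∀ ω ∉ B, ω ∈ S ↔ ω ∈ T) :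
    |μ.real S - μ.real T| ≤ μ.real B := by
  have h1 : μ.real S ≤ μ.real T + μ.real B :=
    (measureReal_mono (fun ω hω => by
      by_cases hB : ω ∈ B
      · exact Or.inr hB
      · exact Or.inl ((h ω hB).1 hω))).trans (measureReal_union_le T B)
  have h2 : μ.real T ≤ μ.real S + μ.real B :=
    (measureReal_mono (fun ω hω => by
      by_cases hB : ω ∈ B
      · exact Or.inr hB
      · exact Or.inl ((h ω hB).2 hω))).trans (measureReal_union_le S B)
  rw [abs_le]
  constructor <;> linarith

end Compare

/-! ### Roots in `ℤ_p` and in `ℚ_p` -/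

section Roots

variable {p : ℕ} [Fact p.Prime]

/-- Hensel's lemma: if the reduction has only simple roots in `𝔽_p`, these correspond to the
roots in `ℤ_p`. -/
lemma encard_roots_eq_numRoots (G : ℤ_[p][X]) (hG : HasSimpleRoots (G.map PadicInt.toZMod)) :
    {x : ℤ_[p] | G.eval x = 0}.encard = numRoots (G.map PadicInt.toZMod) := by
  have hev : ∀ (F : ℤ_[p][X]) x, (F.map PadicInt.toZMod).eval (PadicInt.toZMod x) =
      PadicInt.toZMod (F.eval x) := fun F x => eval_map_apply _ x
  have hbij : Set.BijOn (PadicInt.toZMod (p := p)) {x : ℤ_[p] | G.eval x = 0}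
      (Finset.univ.filter fun a => (G.map PadicInt.toZMod).eval a = 0 : Finset (ZMod p)) := by
    refine ⟨fun x hx => ?_, fun x hx y hy hxy => ?_, fun a ha => ?_⟩
    · simp only [Set.mem_ofPred_eq] at hx
      simp [hev, hx]
    · simp only [Set.mem_ofPred_eq] at hx hy
      by_contra hne
      -- Two roots with the same reduction: dividing the Taylor expansion by `y - x` gives `G'(x) ≡
      -- 0` modulo `p`, contradicting simplicity.
      obtain ⟨k, hk⟩ := binomExpansion G x (y - x)
      rw [add_sub_cancel, hx, hy, zero_add] at hk
      have hz : y - x ≠ 0 := sub_ne_zero.2 (Ne.symm hne)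
      have h0 : G.derivative.eval x + k * (y - x) = 0 := by
        refine (mul_eq_zero.1 ?_).resolve_right hz
        rw [hk]; ring
      have h1 := congrArg (PadicInt.toZMod (p := p)) h0
      rw [map_add, map_mul, map_sub, hxy, sub_self, mul_zero, add_zero, map_zero, ← hev,
        ← derivative_map] at h1
      exact hG _ (by rw [hev, hx, map_zero]) h1
    · have ha' : (G.map PadicInt.toZMod).eval a = 0 := by simpa using ha
      obtain ⟨x, rfl⟩ := toZMod_surjective p a
      have h1 : ‖G.eval x‖ < 1 := by
        rw [PadicInt.norm_lt_one_iff_dvd, ← toZMod_eq_zero_iff_dvd, ← hev, ha']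
      have h2 : ‖G.derivative.eval x‖ = 1 := by
        refine le_antisymm (PadicInt.norm_le_one _) (not_lt.1 fun h => hG _ ha' ?_)
        rwa [derivative_map, hev, toZMod_eq_zero_iff_dvd, ← PadicInt.norm_lt_one_iff_dvd]
      -- As the derivative at `x` is a unit, Hensel's condition reduces to `‖G.eval x‖ < 1`.
      obtain ⟨z, hz, hzx, -⟩ := hensels_lemma (F := G) (a := x) (by
        simpa [aeval_def, h2] using h1)
      refine ⟨z, by simpa [aeval_def] using hz, ?_⟩
      rw [toZMod_eq_iff_norm_sub_lt]
      simpa [aeval_def, h2] using hzx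
  rw [← hbij.2.1.encard_image, hbij.image_eq, Set.encard_coe_eq_coe_finsetCard]
  rfl

lemma encard_roots_le_natDegree {G : ℤ_[p][X]} (hG : G ≠ 0) :
    {x : ℤ_[p] | G.eval x = 0}.encard ≤ G.natDegree := by
  classical
  have : {x : ℤ_[p] | G.eval x = 0} = (G.roots.toFinset : Set ℤ_[p]) := by
    ext x; simp [hG]
  rw [this, Set.encard_coe_eq_coe_finsetCard]
  exact_mod_cast (Multiset.toFinset_card_le _).trans (card_roots' G)

lemma exists_encard_roots_eq {G : ℤ_[p][X]} (hG : G ≠ 0) :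
    ∃ R : ℕ, R ≤ G.natDegree ∧ {x : ℤ_[p] | G.eval x = 0}.encard = R := by
  obtain ⟨R, hR⟩ := ENat.ne_top_iff_exists.1
    (ne_top_of_le_ne_top (ENat.natCast_ne_top _) (encard_roots_le_natDegree hG))
  exact ⟨R, by exact_mod_cast hR.trans_le (encard_roots_le_natDegree hG), hR.symm⟩

/-- If the leading coefficient is a unit, all roots in `ℚ_p` lie in `ℤ_p`. -/
lemma padicRoots_eq_image {f : ℤ_[p][X]} (hf : IsUnit f.leadingCoeff) :
    padicRoots p f = (algebraMap ℤ_[p] ℚ_[p]) '' {x : ℤ_[p] | f.eval x = 0} := by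
  ext x
  simp only [padicRoots, Set.mem_ofPred_eq, Set.mem_image]
  constructor
  · intro hx
    obtain ⟨u, hu⟩ := hf
    have hint : IsIntegral ℤ_[p] x := by
      refine ⟨C (↑u⁻¹ : ℤ_[p]) * f, ?_, ?_⟩
      · rw [Monic, leadingCoeff_mul, leadingCoeff_C, ← hu, Units.inv_mul]
      · rw [eval₂_mul, ← aeval_def, ← aeval_def, hx, mul_zero]
    obtain ⟨y, rfl⟩ := IsIntegrallyClosed.isIntegral_iff.1 hint
    refine ⟨y, ?_, rfl⟩
    rw [aeval_algebraMap_apply, map_eq_zero_iff _ (IsFractionRing.injective ℤ_[p] ℚ_[p])] at hx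
    simpa [aeval_def] using hx
  · rintro ⟨y, hy, rfl⟩
    rw [aeval_algebraMap_apply]
    simp [aeval_def, hy]

lemma encard_padicRoots {f : ℤ_[p][X]} (hf : IsUnit f.leadingCoeff) :
    (padicRoots p f).encard = {x : ℤ_[p] | f.eval x = 0}.encard := by
  rw [padicRoots_eq_image hf]
  exact (IsFractionRing.injective ℤ_[p] ℚ_[p]).encard_image _

lemma encard_rootDSets {f : ℤ_[p][X]} {R : ℕ} (h : (padicRoots p f).encard = R) (d : ℕ) :
    (rootDSets p d f).encard = R.choose d := by
  have hfin : (padicRoots p f).Finite := Set.finite_of_encard_eq_coe h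
  lift padicRoots p f to Finset ℚ_[p] using hfin with Z hZ
  have : rootDSets p d f = (Finset.powersetCard d Z : Set (Finset ℚ_[p])) := by
    ext s
    simp [rootDSets, ← hZ, Finset.mem_powersetCard, and_comm]
  rw [this, Set.encard_coe_eq_coe_finsetCard, Finset.card_powersetCard]
  rw [Set.encard_coe_eq_coe_finsetCard] at h
  congr 2
  exact_mod_cast h

lemma monic_monicPoly (n : ℕ) (a : Fin n → ℤ_[p]) : (monicPoly p n a).Monic :=
  monic_X_pow_add (degree_sum_fin_lt a)

lemma natDegree_monicPoly (n : ℕ) (a : Fin n → ℤ_[p]) : (monicPoly p n a).natDegree = n := by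
  refine natDegree_eq_of_degree_eq_some ?_
  have h := degree_sum_fin_lt a
  rw [monicPoly, degree_add_eq_left_of_degree_lt] <;> rw [degree_X_pow]
  exact h

lemma isUnit_leadingCoeff_monicPoly (n : ℕ) (a : Fin n → ℤ_[p]) :
    IsUnit (monicPoly p n a).leadingCoeff := by
  rw [(monic_monicPoly n a).leadingCoeff]; exact isUnit_one

lemma map_monicPoly (n : ℕ) (a : Fin n → ℤ_[p]) :
    (monicPoly p n a).map PadicInt.toZMod = X ^ n + redHom p n n a := by
  simp [monicPoly, redHom_apply, Polynomial.map_sum]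

lemma map_generalPoly (n : ℕ) (c : Fin (n + 1) → ℤ_[p]) :
    (generalPoly p n c).map PadicInt.toZMod = 0 + redHom p (n + 1) (n + 1) c := by
  rw [generalPoly, redHom_apply, Polynomial.map_sum, zero_add]
  refine Finset.sum_congr rfl fun i _ => ?_
  rw [if_pos i.2]
  simp

lemma map_monicPoly_eq_iff (n : ℕ) (a : Fin n → ℤ_[p]) :
    (monicPoly p n a).map PadicInt.toZMod = X ^ n ↔ ∀ i, (p : ℤ_[p]) ∣ a i := by
  rw [map_monicPoly, add_eq_left]
  constructor
  · intro h i
    rw [← toZMod_eq_zero_iff_dvd, ← coeff_redHom a i i.2, h, coeff_zero]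
  · intro h
    rw [redHom_apply]
    refine Finset.sum_eq_zero fun i _ => ?_
    rw [(toZMod_eq_zero_iff_dvd p _).2 (h i)]
    simp

lemma coeff_monicPoly (n : ℕ) (a : Fin n → ℤ_[p]) (i : Fin n) :
    (monicPoly p n a).coeff i = a i := by
  rw [monicPoly, coeff_add, coeff_X_pow, if_neg i.2.ne, zero_add, finsetSum_coeff,
    Finset.sum_eq_single i]
  · simp
  · intro j _ hj
    rw [coeff_C_mul, coeff_X_pow, if_neg (fun h => hj (Fin.ext h.symm)), mul_zero]
  · simp

/-! ### Divisibility of the coefficients of polynomials with many roots -/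

/-- The polynomial `f` satisfies `p ^ (e - i) ∣ f_i` for all `i < e`: its Newton polygon lies on or
above the line of slope `-1` through `(0, e)`. -/
def CoeffDvd (e : ℕ) (f : ℤ_[p][X]) : Prop :=
  ∀ i, (p : ℤ_[p]) ^ (e - i) ∣ f.coeff i

lemma CoeffDvd.mono {e e' : ℕ} {f : ℤ_[p][X]} (hf : CoeffDvd e' f) (h : e ≤ e') : CoeffDvd e f :=
  fun i => (pow_dvd_pow _ (Nat.sub_le_sub_right h i)).trans (hf i)

/-- Exponents add: `(e - i) + (e' - j) ≥ (e + e') - (i + j)`, and truncation at `0` only enlarges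
the left side. -/
lemma CoeffDvd.mul {e e' : ℕ} {f g : ℤ_[p][X]} (hf : CoeffDvd e f) (hg : CoeffDvd e' g) :
    CoeffDvd (e + e') (f * g) := by
  intro i
  rw [coeff_mul]
  refine Finset.dvd_sum fun x hx => ?_
  have hx' : x.1 + x.2 = i := Finset.HasAntidiagonal.mem_antidiagonal.1 hx
  refine dvd_trans ?_ (mul_dvd_mul (hf x.1) (hg x.2))
  rw [← pow_add]
  exact pow_dvd_pow _ (by omega)

lemma coeffDvd_X_sub_C {r : ℤ_[p]} (hr : (p : ℤ_[p]) ∣ r) : CoeffDvd 1 (X - C r) := by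
  intro i
  rcases Nat.eq_zero_or_pos i with rfl | hi
  · simpa using hr
  · rw [Nat.sub_eq_zero_of_le hi, pow_zero]
    exact one_dvd _

lemma coeffDvd_prod_X_sub_C (s : Finset ℤ_[p]) (hs : ∀ r ∈ s, (p : ℤ_[p]) ∣ r) :
    CoeffDvd s.card (∏ r ∈ s, (X - C r)) := by
  classical
  induction s using Finset.induction_on with
  | empty => intro i; simp
  | insert r s hr ih =>
    rw [Finset.prod_insert hr, Finset.card_insert_of_notMem hr, add_comm]
    exact (coeffDvd_X_sub_C (hs r (Finset.mem_insert_self r s))).mul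
      (ih fun t ht => hs t (Finset.mem_insert_of_mem ht))

lemma dvd_root_of_map_eq_X_pow {n : ℕ} {f : ℤ_[p][X]} (hf : f.map PadicInt.toZMod = X ^ n)
    {x : ℤ_[p]} (hx : f.eval x = 0) : (p : ℤ_[p]) ∣ x := by
  have h : (f.map PadicInt.toZMod).eval (PadicInt.toZMod x) = PadicInt.toZMod (f.eval x) :=
    eval_map_apply _ x
  rw [hf, hx, map_zero, eval_pow, eval_X] at h
  exact (toZMod_eq_zero_iff_dvd p x).1 (eq_zero_of_pow_eq_zero h)

/-- A polynomial with at least `d` roots that reduces to `x ^ n` has highly divisible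
coefficients. -/
lemma coeffDvd_of_roots {n : ℕ} {f : ℤ_[p][X]} (hf : f.map PadicInt.toZMod = X ^ n)
    (s : Finset ℤ_[p]) (hs : ∀ x ∈ s, f.eval x = 0) : CoeffDvd (min (s.card + 1) n) f := by
  have hf0 : f ≠ 0 := by
    rintro rfl
    rw [Polynomial.map_zero] at hf
    exact pow_ne_zero n X_ne_zero hf.symm
  have hp : ∀ r ∈ s, (p : ℤ_[p]) ∣ r := fun r hr => dvd_root_of_map_eq_X_pow hf (hs r hr)
  have hq := coeffDvd_prod_X_sub_C s hp
  have hdvd : (∏ r ∈ s, (X - C r)) ∣ f := by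
    refine (Multiset.prod_X_sub_C_dvd_iff_le_roots hf0 s.val).2 ?_
    rw [Multiset.le_iff_subset s.nodup]
    intro r hr
    exact (mem_roots hf0).2 (hs r hr)
  obtain ⟨h, rfl⟩ := hdvd
  have hh0 : CoeffDvd 0 h := fun i => by simp
  rcases le_or_gt n s.card with hn | hn
  · exact (hq.mul hh0).mono (by omega)
  -- If fewer than `n` roots are split off, the cofactor still reduces to a positive power of `x`,
  -- so `p` divides its constant term. This is the extra `1` in `s.card + 1`.
  · refine (hq.mul (e' := 1) (g := h) fun i => ?_).mono (by omega)
    rcases Nat.eq_zero_or_pos i with rfl | hi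
    · have hX : (∏ r ∈ s, (X - C r)).map (PadicInt.toZMod (p := p)) = X ^ s.card := by
        rw [Polynomial.map_prod, ← Finset.prod_const]
        refine Finset.prod_congr rfl fun r hr => ?_
        rw [Polynomial.map_sub, map_X, map_C, (toZMod_eq_zero_iff_dvd p r).2 (hp r hr), C_0,
          sub_zero]
      rw [Polynomial.map_mul, hX] at hf
      have hc := congrArg (fun q => coeff q s.card) hf
      simp only [coeff_X_pow_mul', le_refl, if_true, Nat.sub_self, coeff_map, coeff_X_pow,
        hn.ne, if_false] at hc
      simpa using (toZMod_eq_zero_iff_dvd p _).1 hc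
    · rw [Nat.sub_eq_zero_of_le hi, pow_zero]
      exact one_dvd _

/-! ### Rescaling -/

/-- The exponents of the powers of `p` that divide the coefficients of a polynomial reducing to
`x ^ n` and satisfying `CoeffDvd k`. -/
def scaleExp (k i : ℕ) : ℕ := max 1 (k - i)

/-- The coefficient vector with entries `p ^ scaleExp k i * b i`. -/
noncomputable def scaleVec (n k : ℕ) (b : Fin n → ℤ_[p]) : Fin n → ℤ_[p] :=
  fun i => (p : ℤ_[p]) ^ scaleExp k i * b i

/-- The polynomial `p ^ (-k) f(p x)` where `f` is monic with coefficient vector `scaleVec n k b`. -/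
noncomputable def scaledPoly (n k : ℕ) (b : Fin n → ℤ_[p]) : ℤ_[p][X] :=
  C ((p : ℤ_[p]) ^ (n - k)) * X ^ n +
    ∑ i : Fin n, C ((p : ℤ_[p]) ^ (scaleExp k i + i - k) * b i) * X ^ (i : ℕ)

/-- The subtractions in the exponents of `scaledPoly` are genuine, since `k ≤ n` and `scaleExp k i ≥
k - i`. -/
lemma eval_scaledPoly {n k : ℕ} (hk : k ≤ n) (b : Fin n → ℤ_[p]) (x : ℤ_[p]) :
    (monicPoly p n (scaleVec n k b)).eval (p * x) = (p : ℤ_[p]) ^ k * (scaledPoly n k b).eval x := by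
  simp only [monicPoly, scaledPoly, scaleVec, eval_add, eval_pow, eval_X, eval_mul, eval_C,
    eval_finsetSum, mul_add, Finset.mul_sum]
  congr 1
  · rw [← mul_assoc, ← pow_add, Nat.add_sub_cancel' hk, mul_pow]
  · refine Finset.sum_congr rfl fun i _ => ?_
    have : (p : ℤ_[p]) ^ scaleExp k i * (p : ℤ_[p]) ^ (i : ℕ) =
        (p : ℤ_[p]) ^ k * (p : ℤ_[p]) ^ (scaleExp k i + i - k) := by
      rw [← pow_add, ← pow_add]
      congr 1
      unfold scaleExp
      omega
    rw [mul_pow]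
    linear_combination (b i * x ^ (i : ℕ)) * this

lemma natCast_prime_ne_zero : (p : ℤ_[p]) ≠ 0 := by
  exact_mod_cast (Fact.out : p.Prime).ne_zero

/-- The exponent `scaleExp k i + i - k` is `0` for `i < k` and positive for `i ≥ k`, so exactly the
coefficients below degree `k` survive, together with the leading `1` when `k = n`. -/
lemma map_scaledPoly {n k : ℕ} (hk : k ≤ n) (b : Fin n → ℤ_[p]) :
    (scaledPoly n k b).map PadicInt.toZMod =
      (if k = n then X ^ n else 0) + redHom p n k b := by
  have hpow : ∀ e : ℕ, PadicInt.toZMod ((p : ℤ_[p]) ^ e) = if e = 0 then 1 else 0 := by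
    intro e
    rw [map_pow, map_natCast, ZMod.natCast_self, zero_pow_eq]
  rw [scaledPoly, redHom_apply, Polynomial.map_add, Polynomial.map_sum]
  congr 1
  · rw [Polynomial.map_mul, map_C, Polynomial.map_pow, map_X, hpow]
    by_cases h : k = n
    · simp [h]
    · rw [if_neg (by omega), if_neg h]; simp
  · refine Finset.sum_congr rfl fun i _ => ?_
    rw [Polynomial.map_mul, map_C, Polynomial.map_pow, map_X, map_mul, hpow]
    by_cases h : (i : ℕ) < k
    · rw [if_pos h, if_pos (by unfold scaleExp; omega), one_mul]
    · rw [if_neg h, if_neg (by unfold scaleExp; omega), zero_mul, C_0, zero_mul]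

lemma dvd_scaleVec (n k : ℕ) (b : Fin n → ℤ_[p]) (i : Fin n) : (p : ℤ_[p]) ∣ scaleVec n k b i :=
  (dvd_pow_self _ (by unfold scaleExp; omega)).mul_right _

/-- All roots are divisible by `p`, so `x ↦ p x` is a bijection from the roots of the rescaled
polynomial. -/
lemma encard_padicRoots_scaleVec {n k : ℕ} (hk : k ≤ n) (b : Fin n → ℤ_[p]) :
    (padicRoots p (monicPoly p n (scaleVec n k b))).encard =
      {x : ℤ_[p] | (scaledPoly n k b).eval x = 0}.encard := by
  rw [encard_padicRoots (isUnit_leadingCoeff_monicPoly n _)]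
  have himg : {x : ℤ_[p] | (monicPoly p n (scaleVec n k b)).eval x = 0} =
      (fun x => (p : ℤ_[p]) * x) '' {x : ℤ_[p] | (scaledPoly n k b).eval x = 0} := by
    ext x
    simp only [Set.mem_ofPred_eq, Set.mem_image]
    constructor
    · intro hx
      obtain ⟨y, rfl⟩ := dvd_root_of_map_eq_X_pow
        ((map_monicPoly_eq_iff n _).2 (dvd_scaleVec n k b)) hx
      rw [eval_scaledPoly hk] at hx
      exact ⟨y, (mul_eq_zero.1 hx).resolve_left (pow_ne_zero _ natCast_prime_ne_zero), rfl⟩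
    · rintro ⟨y, hy, rfl⟩
      rw [eval_scaledPoly hk, hy, mul_zero]
  rw [himg]
  exact (mul_right_injective₀ natCast_prime_ne_zero).encard_image _

lemma mem_range_scaleVec_iff {n k : ℕ} (a : Fin n → ℤ_[p]) :
    a ∈ Set.range (scaleVec (p := p) n k) ↔ ∀ i : Fin n, (p : ℤ_[p]) ^ scaleExp k i ∣ a i := by
  constructor
  · rintro ⟨b, rfl⟩ i
    exact dvd_mul_right _ _
  · intro h
    choose b hb using h
    exact ⟨b, funext fun i => (hb i).symm⟩

/-- A monic polynomial reducing to `x ^ n` with at least `d` roots arises by rescaling. -/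
lemma mem_range_scaleVec_of_le_encard {n d : ℕ} {a : Fin n → ℤ_[p]}
    (ha : (monicPoly p n a).map PadicInt.toZMod = X ^ n)
    (hd : (d : ℕ∞) ≤ (padicRoots p (monicPoly p n a)).encard) :
    a ∈ Set.range (scaleVec (p := p) n (min (d + 1) n)) := by
  rw [encard_padicRoots (isUnit_leadingCoeff_monicPoly n _)] at hd
  obtain ⟨t, hts, ht⟩ := Set.exists_subset_encard_eq hd
  have htf : t.Finite := Set.finite_of_encard_eq_coe ht
  lift t to Finset ℤ_[p] using htf
  rw [Set.encard_coe_eq_coe_finsetCard] at ht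
  have hc : t.card = d := by exact_mod_cast ht
  rw [mem_range_scaleVec_iff]
  intro i
  have h1 := (map_monicPoly_eq_iff n a).1 ha i
  have h2 := coeffDvd_of_roots ha t (fun x hx => hts hx) i
  rw [coeff_monicPoly, hc] at h2
  rcases max_choice 1 (min (d + 1) n - (i : ℕ)) with h | h
  · rw [scaleExp, h, pow_one]; exact h1
  · rw [scaleExp, h]; exact h2

end Roots

/-! ### The Haar measure under rescaling -/

section Scaling

variable {p : ℕ} [Fact p.Prime]

lemma isClosed_setOf_pow_dvd (e : ℕ) : IsClosed {x : ℤ_[p] | (p : ℤ_[p]) ^ e ∣ x} := by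
  have : {x : ℤ_[p] | (p : ℤ_[p]) ^ e ∣ x} = Metric.closedBall 0 ((p : ℝ) ^ (-e : ℤ)) := by
    ext x
    rw [Set.mem_ofPred_eq, mem_closedBall_zero_iff, PadicInt.norm_le_pow_iff_mem_span_pow,
      Ideal.mem_span_singleton]
  rw [this]
  exact Metric.isClosed_closedBall

/-- The set is the kernel of the reduction onto `ZMod (p ^ e)`, all of whose fibres have equal mass.
-/
lemma haarZp_setOf_pow_dvd (e : ℕ) :
    haarZp p {x : ℤ_[p] | (p : ℤ_[p]) ^ e ∣ x} = ((p : ℝ≥0∞) ^ e)⁻¹ := by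
  have h0 : {x : ℤ_[p] | (p : ℤ_[p]) ^ e ∣ x} =
      (PadicInt.toZModPow e : ℤ_[p] →+* ZMod (p ^ e)).toAddMonoidHom ⁻¹' {0} := by
    ext x
    rw [Set.mem_ofPred_eq, ← Ideal.mem_span_singleton, ← PadicInt.ker_toZModPow, RingHom.mem_ker]
    rfl
  have hpe : NeZero (p ^ e) := ⟨pow_ne_zero _ (Fact.out : p.Prime).ne_zero⟩
  have key := measureReal_fiber (haarZp p)
    (PadicInt.toZModPow e : ℤ_[p] →+* ZMod (p ^ e)).toAddMonoidHom
    (ZMod.ringHom_surjective _) (h0 ▸ (isClosed_setOf_pow_dvd e).measurableSet) 0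
  rw [← h0, Nat.card_zmod, measureReal_def] at key
  have hne : ((p ^ e : ℕ) : ℝ≥0∞) ≠ 0 := by exact_mod_cast hpe.ne
  rw [← ENNReal.toReal_eq_toReal_iff' (measure_ne_top _ _), key]
  · simp
  · exact ENNReal.inv_ne_top.2 (pow_ne_zero _ (by exact_mod_cast (Fact.out : p.Prime).ne_zero))

/-- `scaleVec` as an additive homomorphism. -/
noncomputable def scaleHom (p : ℕ) [Fact p.Prime] (n k : ℕ) :
    (Fin n → ℤ_[p]) →+ (Fin n → ℤ_[p]) :=
  AddMonoidHom.mk' (scaleVec n k) (by intro a b; ext i; simp [scaleVec, mul_add])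

lemma measurableEmbedding_scaleVec (n k : ℕ) :
    MeasurableEmbedding (scaleVec (p := p) n k) := by
  refine (Continuous.isClosedEmbedding ?_ ?_).measurableEmbedding
  · unfold scaleVec
    fun_prop
  · intro a b h
    ext1 i
    exact mul_right_injective₀ (pow_ne_zero _ natCast_prime_ne_zero) (congrFun h i)

lemma haarZpPow_range_scaleVec (n k : ℕ) :
    haarZpPow p n (Set.range (scaleVec n k)) =
      ((p : ℝ≥0∞) ^ ∑ i : Fin n, scaleExp k i)⁻¹ := by
  have : Set.range (scaleVec (p := p) n k) =
      Set.univ.pi fun i : Fin n => {x : ℤ_[p] | (p : ℤ_[p]) ^ scaleExp k i ∣ x} := by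
    ext a
    simp only [mem_range_scaleVec_iff, Set.mem_univ_pi, Set.mem_ofPred_eq]
  rw [this, haarZpPow, Measure.pi_pi]
  simp_rw [haarZp_setOf_pow_dvd]
  rw [← Finset.prod_pow_eq_pow_sum, ENNReal.prod_inv_distrib]
  intro i _ j _ _
  left
  exact pow_ne_zero _ (by exact_mod_cast (Fact.out : p.Prime).ne_zero)

/-- Pulling Haar measure back along the injective homomorphism `scaleVec` gives an invariant
measure, hence a multiple of Haar measure; total mass determines the factor. -/
lemma restrict_range_scaleVec (n k : ℕ) :
    (haarZpPow p n).restrict (Set.range (scaleVec n k)) =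
      haarZpPow p n (Set.range (scaleVec n k)) • (haarZpPow p n).map (scaleVec n k) := by
  have hT := measurableEmbedding_scaleVec (p := p) n k
  have hinv : ((haarZpPow p n).comap (scaleVec n k)).IsAddLeftInvariant :=
    Measure.IsAddLeftInvariant.comap (haarZpPow p n) (f := scaleHom p n k) hT
  have hfin : IsFiniteMeasure ((haarZpPow p n).comap (scaleVec n k)) :=
    ⟨by rw [hT.comap_apply]; exact measure_lt_top _ _⟩
  have h := Measure.isAddInvariant_eq_smul_of_compactSpace
    ((haarZpPow p n).comap (scaleVec n k)) (haarZpPow p n)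
  have hc : haarZpPow p n (Set.range (scaleVec n k)) =
      Measure.addHaarScalarFactor ((haarZpPow p n).comap (scaleVec n k)) (haarZpPow p n) := by
    have := congrArg (fun ν => ν Set.univ) h
    simp only [hT.comap_apply, Set.image_univ, Measure.smul_apply, measure_univ] at this
    rw [this]
    simp [ENNReal.smul_def]
  rw [← hT.map_comap, hc]
  conv_lhs => rw [h]
  rw [Measure.map_smul]
  rfl

/-- The source of the exponent `k.choose 2`: beyond one factor `p` per coefficient, which the
conditioning provides, the extra exponents are `k - 1, k - 2, …, 0`. -/
lemma sum_scaleExp {n k : ℕ} (hk : k ≤ n) : ∑ i : Fin n, scaleExp k i = n + k.choose 2 := by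
  rw [Fin.sum_univ_eq_sum_range (scaleExp k) n]
  have h1 : ∀ i ∈ Finset.range n, scaleExp k i = 1 + (k - 1 - i) := by
    intro i _
    unfold scaleExp
    omega
  rw [Finset.sum_congr rfl h1, Finset.sum_add_distrib, Finset.sum_const, Finset.card_range,
    smul_eq_mul, mul_one, Nat.choose_two_right, ← Finset.sum_range_id,
    ← Finset.sum_range_reflect (fun i => i) k]
  congr 1
  symm
  refine Finset.sum_subset (Finset.range_mono hk) fun i _ hi => ?_
  rw [Finset.mem_range] at hi
  omega

/-- The conditioning event is the case `k = 0` of rescaling, so its mass comes from the same volume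
formula. -/
lemma range_scaleVec_zero (n : ℕ) : Set.range (scaleVec (p := p) n 0) =
    {a | (monicPoly p n a).map (PadicInt.toZMod (p := p)) = X ^ n} := by
  ext a
  rw [Set.mem_ofPred_eq, mem_range_scaleVec_iff, map_monicPoly_eq_iff]
  simp [scaleExp]

/-- Conditioning divides the mass `p ^ (-(n + k.choose 2))` of the range by `p ^ (-n)`. -/
lemma restrict_haarReducing {n k : ℕ} (hk : k ≤ n) :
    (haarReducing p n).restrict (Set.range (scaleVec n k)) =
      ((p : ℝ≥0∞) ^ k.choose 2)⁻¹ • (haarZpPow p n).map (scaleVec n k) := by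
  have hm := (measurableEmbedding_scaleVec (p := p) n k).measurableSet_range
  have hsub : Set.range (scaleVec (p := p) n k) ⊆ Set.range (scaleVec n 0) := by
    rw [range_scaleVec_zero]
    rintro _ ⟨b, rfl⟩
    exact (map_monicPoly_eq_iff n _).2 (dvd_scaleVec n k b)
  rw [haarReducing, ← range_scaleVec_zero, ProbabilityTheory.cond, Measure.restrict_smul,
    Measure.restrict_restrict hm, Set.inter_eq_left.2 hsub, restrict_range_scaleVec, smul_smul,
    haarZpPow_range_scaleVec, haarZpPow_range_scaleVec, sum_scaleExp hk, sum_scaleExp (zero_le),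
    inv_inv]
  congr 1
  have h0 : (p : ℝ≥0∞) ≠ 0 := by exact_mod_cast (Fact.out : p.Prime).ne_zero
  have h0' := pow_ne_zero n h0
  have htop : (p : ℝ≥0∞) ^ n ≠ ∞ := ENNReal.pow_ne_top (ENNReal.natCast_ne_top p)
  rw [Nat.choose_zero_succ, add_zero, pow_add, ENNReal.mul_inv (Or.inl h0') (Or.inl htop),
    ← mul_assoc, ENNReal.mul_inv_cancel h0' htop, one_mul]

lemma haarReducing_compl_range (n : ℕ) :
    haarReducing p n (Set.range (scaleVec n 0))ᶜ = 0 := by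
  have hm := (measurableEmbedding_scaleVec (p := p) n 0).measurableSet_range
  rw [haarReducing, ← range_scaleVec_zero, ProbabilityTheory.cond_apply hm,
    Set.inter_compl_self, measure_empty, mul_zero]

lemma pow_mul_toReal_inv_pow_mul (e : ℕ) (x : ℝ≥0∞) :
    (p : ℝ) ^ e * (((p : ℝ≥0∞) ^ e)⁻¹ * x).toReal = x.toReal := by
  have h0 : (p : ℝ) ^ e ≠ 0 := pow_ne_zero _ (by exact_mod_cast (Fact.out : p.Prime).ne_zero)
  rw [ENNReal.toReal_mul, ENNReal.toReal_inv, ENNReal.toReal_pow, ENNReal.toReal_natCast,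
    mul_inv_cancel_left₀ h0]

/-- Change of variables for a function that is supported on the image of `scaleVec`. -/
lemma pow_mul_lintegral_haarReducing {n k : ℕ} (hk : k ≤ n) (F : (Fin n → ℤ_[p]) → ℝ≥0∞)
    (hF : ∀ a, (monicPoly p n a).map (PadicInt.toZMod (p := p)) = X ^ n →
      a ∉ Set.range (scaleVec n k) → F a = 0) :
    (p : ℝ) ^ k.choose 2 * (∫⁻ a, F a ∂haarReducing p n).toReal =
      (∫⁻ b, F (scaleVec n k b) ∂haarZpPow p n).toReal := by
  have hT := measurableEmbedding_scaleVec (p := p) n k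
  have hzero : ∫⁻ a in (Set.range (scaleVec n k))ᶜ, F a ∂haarReducing p n = 0 := by
    rw [← lintegral_zero (μ := (haarReducing p n).restrict (Set.range (scaleVec n k))ᶜ)]
    refine lintegral_congr_ae ?_
    rw [EventuallyEq, ae_restrict_iff' hT.measurableSet_range.compl]
    have : ∀ᵐ a ∂haarReducing p n, a ∈ Set.range (scaleVec (p := p) n 0) :=
      haarReducing_compl_range n
    filter_upwards [this] with a ha hak
    rw [range_scaleVec_zero] at ha
    exact hF a ha hak
  rw [← lintegral_add_compl F hT.measurableSet_range, hzero, add_zero, restrict_haarReducing hk,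
    lintegral_smul_measure, hT.lintegral_map, smul_eq_mul, pow_mul_toReal_inv_pow_mul]

/-- Change of variables for a set that is contained in the image of `scaleVec`. -/
lemma pow_mul_haarReducing {n k : ℕ} (hk : k ≤ n) (S : Set (Fin n → ℤ_[p]))
    (hS : ∀ a ∈ S, (monicPoly p n a).map (PadicInt.toZMod (p := p)) = X ^ n →
      a ∈ Set.range (scaleVec n k)) :
    (p : ℝ) ^ k.choose 2 * (haarReducing p n S).toReal =
      (haarZpPow p n).real (scaleVec n k ⁻¹' S) := by
  have hT := measurableEmbedding_scaleVec (p := p) n k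
  have hzero : haarReducing p n (S \ Set.range (scaleVec n k)) = 0 := by
    refine measure_mono_null ?_ (haarReducing_compl_range n)
    rintro a ⟨ha, hak⟩ ha0
    rw [range_scaleVec_zero] at ha0
    exact hak (hS a ha ha0)
  rw [← measure_inter_add_sdiff S hT.measurableSet_range, hzero, add_zero,
    ← Measure.restrict_apply' hT.measurableSet_range, restrict_haarReducing hk,
    Measure.smul_apply, hT.map_apply, smul_eq_mul, pow_mul_toReal_inv_pow_mul]
  rfl

end Scaling

/-! ### Binomial inversion -/

/-- Terms with `d < r` vanish through `d.choose r`, so negative powers of `-1` never contribute. -/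
lemma sum_neg_one_zpow_choose_mul {n r : ℕ} (hr : r ≤ n) (c : ℕ → ℝ) :
    ∑ d ∈ Finset.range (n + 1), (-1 : ℝ) ^ ((d : ℤ) - (r : ℤ)) * (d.choose r : ℝ) * c d =
      ∑ j ∈ Finset.range (n - r + 1), (-1 : ℝ) ^ j * ((r + j).choose r : ℝ) * c (r + j) := by
  have h : ∑ d ∈ Finset.Ico r (n + 1), (-1 : ℝ) ^ ((d : ℤ) - (r : ℤ)) * (d.choose r : ℝ) * c d =
      ∑ d ∈ Finset.range (n + 1), (-1 : ℝ) ^ ((d : ℤ) - (r : ℤ)) * (d.choose r : ℝ) * c d := by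
    refine Finset.sum_subset (fun d hd => ?_) fun d hd hd' => ?_
    · rw [Finset.mem_Ico] at hd
      exact Finset.mem_range.2 hd.2
    · rw [Finset.mem_Ico] at hd'
      rw [Finset.mem_range] at hd
      rw [Nat.choose_eq_zero_of_lt (by omega)]
      simp
  rw [← h, Finset.sum_Ico_eq_sum_range, Nat.sub_add_comm hr]
  refine Finset.sum_congr rfl fun j _ => ?_
  have : ((r + j : ℕ) : ℤ) - (r : ℤ) = (j : ℕ) := by push_cast; ring
  rw [this, zpow_natCast]

/-- Since `(N choose d) (d choose r) = (N choose r) (N - r choose d - r)`, the sum is a multiple of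
the alternating row sum of order `N - r`. -/
lemma sum_neg_one_zpow_choose_mul_choose {n N r : ℕ} (hN : N ≤ n) :
    ∑ d ∈ Finset.range (n + 1),
      (-1 : ℝ) ^ ((d : ℤ) - (r : ℤ)) * (d.choose r : ℝ) * (N.choose d : ℝ) =
      if N = r then 1 else 0 := by
  have h : ∑ d ∈ Finset.range (N + 1),
        (-1 : ℝ) ^ ((d : ℤ) - (r : ℤ)) * (d.choose r : ℝ) * (N.choose d : ℝ) =
      ∑ d ∈ Finset.range (n + 1),
        (-1 : ℝ) ^ ((d : ℤ) - (r : ℤ)) * (d.choose r : ℝ) * (N.choose d : ℝ) := by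
    refine Finset.sum_subset (Finset.range_mono (by omega)) fun d _ hd => ?_
    rw [Finset.mem_range] at hd
    rw [Nat.choose_eq_zero_of_lt (show N < d by omega)]
    simp
  rw [← h]
  rcases lt_or_ge N r with hNr | hNr
  · rw [if_neg hNr.ne]
    refine Finset.sum_eq_zero fun d hd => ?_
    rw [Finset.mem_range] at hd
    rw [Nat.choose_eq_zero_of_lt (show d < r by omega)]
    simp
  · rw [sum_neg_one_zpow_choose_mul hNr]
    have hterm : ∀ j ∈ Finset.range (N - r + 1),
        (-1 : ℝ) ^ j * ((r + j).choose r : ℝ) * (N.choose (r + j) : ℝ) =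
          (N.choose r : ℝ) * (((-1) ^ j * ((N - r).choose j : ℤ) : ℤ) : ℝ) := by
      intro j hj
      rw [Finset.mem_range] at hj
      have := Nat.choose_mul (n := N) (k := r + j) (s := r) (by omega)
      rw [Nat.add_sub_cancel_left] at this
      have h' : (N.choose (r + j) : ℝ) * ((r + j).choose r : ℝ) =
          (N.choose r : ℝ) * ((N - r).choose j : ℝ) := by exact_mod_cast this
      push_cast
      linear_combination (-1 : ℝ) ^ j * h'
    rw [Finset.sum_congr rfl hterm, ← Finset.mul_sum, ← Int.cast_sum,
      Int.alternating_sum_range_choose]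
    by_cases hr : N = r
    · simp [hr]
    · rw [if_neg (by omega), if_neg hr]
      simp

lemma sum_neg_one_zpow_choose_div_factorial {n r : ℕ} (hr : r ≤ n) :
    ∑ d ∈ Finset.range (n + 1),
      (-1 : ℝ) ^ ((d : ℤ) - (r : ℤ)) * (d.choose r : ℝ) * (1 / (d.factorial : ℝ)) =
    1 / (r.factorial : ℝ) *
      ∑ d ∈ Finset.range (n - r + 1), (-1 : ℝ) ^ d * (1 / (d.factorial : ℝ)) := by
  rw [sum_neg_one_zpow_choose_mul hr fun d => 1 / (d.factorial : ℝ), Finset.mul_sum]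
  refine Finset.sum_congr rfl fun j _ => ?_
  have h := Nat.add_choose_mul_factorial_mul_factorial r j
  rw [← Nat.choose_symm_add] at h
  have h' : ((r + j).choose r : ℝ) * r.factorial * j.factorial = (r + j).factorial := by
    exact_mod_cast h
  have h1 : (r.factorial : ℝ) ≠ 0 := by positivity
  have h2 : (j.factorial : ℝ) ≠ 0 := by positivity
  have h3 : ((r + j).factorial : ℝ) ≠ 0 := by positivity
  field_simp
  linear_combination h'

lemma tendsto_sum_neg_one_pow_div_factorial (r : ℕ) :
    Tendsto (fun n : ℕ => 1 / (r.factorial : ℝ) *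
      ∑ d ∈ Finset.range (n - r + 1), (-1 : ℝ) ^ d * (1 / (d.factorial : ℝ))) atTop
      (𝓝 (1 / (r.factorial : ℝ) * Real.exp (-1))) := by
  refine Tendsto.const_mul _ ?_
  have h : HasSum (fun d : ℕ => (-1 : ℝ) ^ d * (1 / (d.factorial : ℝ))) (Real.exp (-1)) := by
    rw [Real.exp_eq_exp_ℝ]
    simpa [div_eq_mul_inv] using NormedSpace.expSeries_div_hasSum_exp (𝔸 := ℝ) (-1)
  exact h.tendsto_sum_nat.comp ((tendsto_add_atTop_nat 1).comp (tendsto_sub_atTop_nat r))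

/-! ### Comparison with the reduction modulo `p` -/

section Comparison

variable {p : ℕ} [Fact p.Prime]

open Classical in
/-- The indicator of the polynomials with simple roots and exactly `r` roots in `𝔽_p`. -/
noncomputable def exactWeight (r : ℕ) (g : (ZMod p)[X]) : ℝ :=
  if HasSimpleRoots g ∧ numRoots g = r then 1 else 0

lemma exactWeight_eq_sum {r n : ℕ} {g : (ZMod p)[X]} (hg : g.natDegree ≤ n) :
    exactWeight r g = ∑ d ∈ Finset.range (n + 1),
      (-1 : ℝ) ^ ((d : ℤ) - (r : ℤ)) * (d.choose r : ℝ) * rootWeight d g := by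
  unfold exactWeight rootWeight
  by_cases h : HasSimpleRoots g
  · simp only [h, true_and, if_true]
    exact (sum_neg_one_zpow_choose_mul_choose
      ((numRoots_le_natDegree h.ne_zero).trans hg)).symm
  · simp [h]

/-- The converse of the inversion, needed because `rho` is defined through `rhoStar` and not as an
integral. -/
lemma rootWeight_eq_sum {d n : ℕ} {g : (ZMod p)[X]} (hg : g.natDegree ≤ n) :
    rootWeight d g = ∑ r ∈ Finset.range (n + 1), (r.choose d : ℝ) * exactWeight r g := by
  unfold exactWeight rootWeight
  by_cases h : HasSimpleRoots g
  · have := (numRoots_le_natDegree h.ne_zero).trans hg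
    simp only [h, true_and, if_true, mul_ite, mul_one, mul_zero]
    rw [Finset.sum_ite_eq, if_pos (Finset.mem_range.2 (by omega))]
  · simp [h]

variable {N m : ℕ} {A : (ZMod p)[X]}

lemma integrable_rootWeight (d : ℕ) :
    Integrable (fun b => rootWeight d (A + redHom p N m b)) (haarZpPow p N) :=
  integrable_comp_redHom (fun q => rootWeight d (A + q)) (p.choose d) fun _ =>
    abs_rootWeight_le d _

lemma integrable_exactWeight (r : ℕ) :
    Integrable (fun b => exactWeight r (A + redHom p N m b)) (haarZpPow p N) :=
  integrable_comp_redHom (fun q => exactWeight r (A + q)) 1 fun _ => by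
    unfold exactWeight; split_ifs <;> simp

open Classical in
lemma integral_exactWeight (r : ℕ) :
    ∫ b, exactWeight r (A + redHom p N m b) ∂haarZpPow p N = (haarZpPow p N).real
      {b | HasSimpleRoots (A + redHom p N m b) ∧ numRoots (A + redHom p N m b) = r} := by
  rw [← integral_indicator_one]
  · simp [Set.indicator_apply, exactWeight]
  · exact measurableSet_redHom_preimage {q | HasSimpleRoots (A + q) ∧ numRoots (A + q) = r}

lemma integral_exactWeight_eq_sum {r n : ℕ} (hdeg : ∀ b, (A + redHom p N m b).natDegree ≤ n) :
    ∫ b, exactWeight r (A + redHom p N m b) ∂haarZpPow p N = ∑ d ∈ Finset.range (n + 1),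
      (-1 : ℝ) ^ ((d : ℤ) - (r : ℤ)) * (d.choose r : ℝ) *
        ∫ b, rootWeight d (A + redHom p N m b) ∂haarZpPow p N := by
  simp_rw [fun b => exactWeight_eq_sum (r := r) (hdeg b)]
  rw [integral_finsetSum _ fun d _ => (integrable_rootWeight d).const_mul _]
  simp_rw [integral_const_mul]

lemma integral_rootWeight_eq_sum {d n : ℕ} (hdeg : ∀ b, (A + redHom p N m b).natDegree ≤ n) :
    ∫ b, rootWeight d (A + redHom p N m b) ∂haarZpPow p N = ∑ r ∈ Finset.range (n + 1),
      (r.choose d : ℝ) * ∫ b, exactWeight r (A + redHom p N m b) ∂haarZpPow p N := by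
  simp_rw [fun b => rootWeight_eq_sum (d := d) (hdeg b)]
  rw [integral_finsetSum _ fun d _ => (integrable_exactWeight d).const_mul _]
  simp_rw [integral_const_mul]

/-- The expected number of `d`-sets of `ℚ_p`-roots is close to that of the reduction. -/
lemma abs_lintegral_rootDSets_sub_le {n d : ℕ} (f : (Fin N → ℤ_[p]) → ℤ_[p][X])
    (hdeg : ∀ b, (A + redHom p N m b).natDegree ≤ n)
    (hR : ∀ b, ∃ R : ℕ, R ≤ n ∧ (padicRoots p (f b)).encard = R)
    (hf : ∀ b, HasSimpleRoots (A + redHom p N m b) →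
      (padicRoots p (f b)).encard = numRoots (A + redHom p N m b))
    (hsimple : (haarZpPow p N).real {b | ¬ HasSimpleRoots (A + redHom p N m b)} ≤ 1 / p) :
    |(∫⁻ b, ((rootDSets p d (f b)).encard : ℝ≥0∞) ∂haarZpPow p N).toReal -
      ∫ b, rootWeight d (A + redHom p N m b) ∂haarZpPow p N| ≤ n.choose d / p := by
  refine (abs_toReal_lintegral_sub_integral_le (haarZpPow p N)
    (B := {b | ¬ HasSimpleRoots (A + redHom p N m b)}) (K := n.choose d)
    (measurableSet_redHom_preimage {q | ¬ HasSimpleRoots (A + q)})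
    (measurable_comp_redHom fun q => rootWeight d (A + q)) (fun _ => rootWeight_nonneg d _)
    (fun b => rootWeight_le (hdeg b)) (fun b => ?_) (fun b hb => ?_)).trans ?_
  · obtain ⟨R, hRn, hR⟩ := hR b
    rw [encard_rootDSets hR, ENNReal.ofReal_natCast]
    exact_mod_cast Nat.choose_le_choose d hRn
  · simp only [Set.mem_ofPred_eq, not_not] at hb
    rw [encard_rootDSets (hf b hb), rootWeight, if_pos hb, ENNReal.ofReal_natCast]
    rfl
  · rw [div_eq_mul_one_div]
    exact mul_le_mul_of_nonneg_left hsimple (by positivity)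

/-- The probability of having exactly `r` roots in `ℚ_p` is close to that for the reduction. -/
lemma abs_measureReal_encard_sub_le (f : (Fin N → ℤ_[p]) → ℤ_[p][X]) (r : ℕ)
    {B : Set (Fin N → ℤ_[p])} (hB : ∀ b ∉ B, HasSimpleRoots (A + redHom p N m b) ∧
      (padicRoots p (f b)).encard = numRoots (A + redHom p N m b)) :
    |(haarZpPow p N).real {b | (padicRoots p (f b)).encard = r} -
      ∫ b, exactWeight r (A + redHom p N m b) ∂haarZpPow p N| ≤ (haarZpPow p N).real B := by
  rw [integral_exactWeight]
  refine abs_measureReal_sub_le _ fun b hb => ?_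
  obtain ⟨h1, h2⟩ := hB b hb
  simp only [Set.mem_ofPred_eq, h2, h1, true_and, Nat.cast_inj]

end Comparison

/-! ### Error bounds for the general, monic and conditioned families. -/

section Families

variable {p : ℕ} [Fact p.Prime]

lemma exists_encard_padicRoots_monicPoly (n : ℕ) (a : Fin n → ℤ_[p]) :
    ∃ R : ℕ, R ≤ n ∧ (padicRoots p (monicPoly p n a)).encard = R := by
  obtain ⟨R, h1, h2⟩ := exists_encard_roots_eq (monic_monicPoly n a).ne_zero
  rw [natDegree_monicPoly] at h1
  exact ⟨R, h1, by rw [encard_padicRoots (isUnit_leadingCoeff_monicPoly n a), h2]⟩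

lemma encard_padicRoots_monicPoly_eq_numRoots (n : ℕ) (a : Fin n → ℤ_[p])
    (h : HasSimpleRoots (X ^ n + redHom p n n a)) :
    (padicRoots p (monicPoly p n a)).encard = numRoots (X ^ n + redHom p n n a) := by
  rw [← map_monicPoly] at h ⊢
  rw [encard_padicRoots (isUnit_leadingCoeff_monicPoly n a), encard_roots_eq_numRoots _ h]

lemma encard_padicRoots_scaleVec_eq_numRoots {n k : ℕ} (hk : k ≤ n) (b : Fin n → ℤ_[p])
    (h : HasSimpleRoots ((if k = n then X ^ n else 0) + redHom p n k b)) :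
    (padicRoots p (monicPoly p n (scaleVec n k b))).encard =
      numRoots ((if k = n then X ^ n else 0) + redHom p n k b) := by
  rw [← map_scaledPoly hk] at h ⊢
  rw [encard_padicRoots_scaleVec hk, encard_roots_eq_numRoots _ h]

lemma natDegree_redHom_le {N m : ℕ} (b : Fin N → ℤ_[p]) :
    (redHom p N m b).natDegree ≤ m - 1 := by
  refine natDegree_le_of_degree_le ?_
  have h := degree_redHom_lt (p := p) (m := m) b
  rcases m with _ | m
  · exact h.le.trans (by simp)
  · exact Order.le_of_lt_succ h

lemma natDegree_ite_add_redHom_le {n k : ℕ} (b : Fin n → ℤ_[p]) (hk : k ≤ n) :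
    ((if k = n then X ^ n else 0) + redHom p n k b).natDegree ≤ n := by
  split_ifs with h
  · subst h; exact (natDegree_X_pow_add_redHom b).le
  · rw [zero_add]; exact (natDegree_redHom_le b).trans (by omega)

lemma measureReal_not_hasSimpleRoots_ite {n k : ℕ} (hk : k ≤ n) (hk' : k = n ∨ 1 ≤ k) :
    (haarZpPow p n).real
      {b | ¬ HasSimpleRoots ((if k = n then X ^ n else 0) + redHom p n k b)} ≤ 1 / p := by
  by_cases h : k = n
  · subst h
    simpa using measureReal_not_hasSimpleRoots_monic (p := p) k
  · simp only [h, if_false]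
    exact measureReal_not_hasSimpleRoots_redHom hk (by omega)

lemma abs_integral_rootWeight_ite_sub_le {n d : ℕ} (hd : d ≤ n) :
    |∫ b, rootWeight d ((if min (d + 1) n = n then X ^ n else 0) +
        redHom p n (min (d + 1) n) b) ∂haarZpPow p n - (p.choose d : ℝ) / (p : ℝ) ^ d| ≤
      (n.choose d + 1) / p := by
  by_cases h : min (d + 1) n = n
  · rw [h]
    simpa using abs_integral_rootWeight_monic_sub_le (p := p) hd
  · simp only [h, if_false]
    have hk : min (d + 1) n = d + 1 := by omega
    rw [hk]
    refine (abs_integral_rootWeight_redHom_sub_le (p := p) (N := n) (by omega)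
      (Nat.lt_succ_self d)).trans ?_
    gcongr
    omega

lemma abs_alpha_sub_le {n d : ℕ} :
    |alpha p n d - ∫ b, rootWeight d (X ^ n + redHom p n n b) ∂haarZpPow p n| ≤
      n.choose d / p :=
  abs_lintegral_rootDSets_sub_le (monicPoly p n) (fun b => (natDegree_X_pow_add_redHom b).le)
    (exists_encard_padicRoots_monicPoly n) (encard_padicRoots_monicPoly_eq_numRoots n)
    (measureReal_not_hasSimpleRoots_monic n)

lemma abs_alphaStar_sub_le (n r : ℕ) :
    |alphaStar p n r - ∫ b, exactWeight r (X ^ n + redHom p n n b) ∂haarZpPow p n| ≤ 2 / p := by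
  refine (abs_measureReal_encard_sub_le (monicPoly p n) r
    (B := {b | ¬ HasSimpleRoots (X ^ n + redHom p n n b)}) fun b hb => ?_).trans
      ((measureReal_not_hasSimpleRoots_monic n).trans ?_)
  · have hb' := not_not.1 hb
    exact ⟨hb', encard_padicRoots_monicPoly_eq_numRoots n b hb'⟩
  · gcongr
    norm_num

lemma coeff_generalPoly (n : ℕ) (c : Fin (n + 1) → ℤ_[p]) :
    (generalPoly p n c).coeff n = c (Fin.last n) := by
  rw [generalPoly, finsetSum_coeff, Finset.sum_eq_single (Fin.last n)]
  · simp
  · intro j _ hj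
    rw [coeff_C_mul, coeff_X_pow, if_neg (fun h => hj (Fin.ext (by simp [← h]))), mul_zero]
  · simp

lemma isUnit_leadingCoeff_generalPoly {n : ℕ} {c : Fin (n + 1) → ℤ_[p]}
    (hc : PadicInt.toZMod (c (Fin.last n)) ≠ 0) : IsUnit (generalPoly p n c).leadingCoeff := by
  have hunit : IsUnit (c (Fin.last n)) := by
    by_contra h
    refine hc ((toZMod_eq_zero_iff_dvd p _).2 ?_)
    rwa [← PadicInt.norm_lt_one_iff_dvd, ← PadicInt.mem_nonunits]
  have hdeg : (generalPoly p n c).natDegree = n := by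
    refine natDegree_eq_of_le_of_coeff_ne_zero ?_ ?_
    · refine natDegree_le_of_degree_le (Order.le_of_lt_succ ?_)
      exact degree_sum_fin_lt c
    · rw [coeff_generalPoly]
      exact hunit.ne_zero
  rwa [leadingCoeff, hdeg, coeff_generalPoly]

lemma measureReal_last_eq_zero (n : ℕ) :
    (haarZpPow p (n + 1)).real {c | PadicInt.toZMod (c (Fin.last n)) = 0} = 1 / p := by
  have key := measureReal_redHom_fiber (p := p) (le_refl (n + 1))
    (lcoeff (ZMod p) n).toAddMonoidHom (fun h => ⟨C h * X ^ n, ?_, by simp⟩) 0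
  · rw [Nat.card_zmod] at key
    rw [one_div, ← key]
    congr 1
    ext c
    have := coeff_redHom (m := n + 1) c (Fin.last n) (by simp)
    rw [Fin.val_last] at this
    simp [this]
  · refine (degree_C_mul_X_pow_le _ _).trans_lt ?_
    exact_mod_cast Nat.lt_succ_self n

/-- Two exceptional events, each of probability at most `1 / p`: a multiple root modulo `p`, and a
leading coefficient divisible by `p`, which could allow roots outside `ℤ_p`. -/
lemma abs_rhoStar_sub_le (n r : ℕ) :
    |rhoStar p n r -
      ∫ b, exactWeight r (0 + redHom p (n + 1) (n + 1) b) ∂haarZpPow p (n + 1)| ≤ 2 / p := by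
  refine (abs_measureReal_encard_sub_le (generalPoly p n) r
    (B := {b | ¬ HasSimpleRoots (0 + redHom p (n + 1) (n + 1) b)} ∪
      {c | PadicInt.toZMod (c (Fin.last n)) = 0}) fun b hb => ?_).trans
      ((measureReal_union_le _ _).trans ?_)
  · rw [Set.mem_union, not_or] at hb
    have hb' := not_not.1 hb.1
    refine ⟨hb', ?_⟩
    rw [← map_generalPoly] at hb' ⊢
    rw [encard_padicRoots (isUnit_leadingCoeff_generalPoly hb.2), encard_roots_eq_numRoots _ hb']
  · rw [measureReal_last_eq_zero]
    have := measureReal_not_hasSimpleRoots_redHom (p := p) (le_refl (n + 1)) (by omega)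
    have h2 : (2 : ℝ) / p = 1 / p + 1 / p := by ring
    rw [h2]
    gcongr

lemma natDegree_zero_add_redHom_le (n : ℕ) (b : Fin (n + 1) → ℤ_[p]) :
    (0 + redHom p (n + 1) (n + 1) b).natDegree ≤ n := by
  rw [zero_add]
  exact natDegree_redHom_le b

lemma abs_rho_sub_le (n d : ℕ) :
    |rho p n d -
      ∫ b, rootWeight d (0 + redHom p (n + 1) (n + 1) b) ∂haarZpPow p (n + 1)| ≤
      (∑ r ∈ Finset.range (n + 1), (r.choose d : ℝ) * 2) / p := by
  rw [integral_rootWeight_eq_sum (natDegree_zero_add_redHom_le n), rho, ← Finset.sum_sub_distrib,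
    Finset.sum_div]
  refine (Finset.abs_sum_le_sum_abs _ _).trans (Finset.sum_le_sum fun r _ => ?_)
  rw [← mul_sub, abs_mul, abs_of_nonneg (by positivity), mul_div_assoc]
  exact mul_le_mul_of_nonneg_left (abs_rhoStar_sub_le n r) (by positivity)

lemma abs_pow_mul_beta_sub_le {n d : ℕ} (hd : d ≤ n) :
    |(p : ℝ) ^ (min (d + 1) n).choose 2 * beta p n d -
      ∫ b, rootWeight d ((if min (d + 1) n = n then X ^ n else 0) +
        redHom p n (min (d + 1) n) b) ∂haarZpPow p n| ≤ n.choose d / p := by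
  have hk : min (d + 1) n ≤ n := min_le_right _ _
  rw [beta, pow_mul_lintegral_haarReducing hk]
  · exact abs_lintegral_rootDSets_sub_le (fun b => monicPoly p n (scaleVec n (min (d + 1) n) b))
      (fun b => natDegree_ite_add_redHom_le b hk)
      (fun b => exists_encard_padicRoots_monicPoly n _)
      (fun b => encard_padicRoots_scaleVec_eq_numRoots hk b)
      (measureReal_not_hasSimpleRoots_ite hk (by omega))
  -- Outside the range of `scaleVec` there are fewer than `d` roots, hence no `d`-sets.
  · intro a ha hak
    obtain ⟨R, -, hR⟩ := exists_encard_padicRoots_monicPoly n a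
    rw [encard_rootDSets hR, Nat.choose_eq_zero_of_lt]
    · simp
    · by_contra hRd
      refine hak (mem_range_scaleVec_of_le_encard ha ?_)
      rw [hR]
      exact_mod_cast not_lt.1 hRd

/-- The rescaled reduction has degree at most `r`: it has degree less than `k = r + 1` if `r + 1 <
n`, and degree `n` if `r = n`. So having exactly `r` roots is the same as having an `r`-set of
roots. For `r = n - 1` the reduction is monic of degree `r + 1` and this fails. -/
lemma abs_pow_mul_betaStar_sub_le {n r : ℕ} (hr : r ≤ n) (hrn : r + 1 ≠ n) :
    |(p : ℝ) ^ (min (r + 1) n).choose 2 * betaStar p n r -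
      ∫ b, rootWeight r ((if min (r + 1) n = n then X ^ n else 0) +
        redHom p n (min (r + 1) n) b) ∂haarZpPow p n| ≤ 1 / p := by
  have hk : min (r + 1) n ≤ n := min_le_right _ _
  have hdeg : ∀ b, ((if min (r + 1) n = n then X ^ n else 0) +
      redHom p n (min (r + 1) n) b).natDegree ≤ r := by
    intro b
    by_cases h : r = n
    · exact (natDegree_ite_add_redHom_le b hk).trans h.ge
    · rw [if_neg (by omega), zero_add]
      exact (natDegree_redHom_le b).trans (by omega)
  have hexact : ∫ b, exactWeight r ((if min (r + 1) n = n then X ^ n else 0) +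
        redHom p n (min (r + 1) n) b) ∂haarZpPow p n =
      ∫ b, rootWeight r ((if min (r + 1) n = n then X ^ n else 0) +
        redHom p n (min (r + 1) n) b) ∂haarZpPow p n := by
    -- With degree bound `r`, the inversion formula has the single term `d = r`.
    rw [integral_exactWeight_eq_sum hdeg, sum_neg_one_zpow_choose_mul le_rfl
      fun d => ∫ b, rootWeight d ((if min (r + 1) n = n then X ^ n else 0) +
        redHom p n (min (r + 1) n) b) ∂haarZpPow p n]
    simp
  rw [betaStar, pow_mul_haarReducing hk, ← hexact]
  · refine (abs_measureReal_encard_sub_le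
      (fun b => monicPoly p n (scaleVec n (min (r + 1) n) b)) r
      (B := {b | ¬ HasSimpleRoots ((if min (r + 1) n = n then X ^ n else 0) +
        redHom p n (min (r + 1) n) b)}) fun b hb => ?_).trans
      (measureReal_not_hasSimpleRoots_ite hk (by omega))
    have hb' := not_not.1 hb
    exact ⟨hb', encard_padicRoots_scaleVec_eq_numRoots hk b hb'⟩
  · intro a ha h
    exact mem_range_scaleVec_of_le_encard h (le_of_eq (Eq.symm ha))

end Families

/-! ### Limits -/

lemma tendsto_natCast_primesAtTop :
    Tendsto (fun p : Nat.Primes => (p : ℕ)) primesAtTop atTop := tendsto_comap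

lemma tendsto_of_abs_sub_le {q r : Nat.Primes → ℝ} {K l : ℝ}
    (h : ∀ p : Nat.Primes, |q p - r p| ≤ K / ((p : ℕ) : ℝ)) (hr : Tendsto r primesAtTop (𝓝 l)) :
    Tendsto q primesAtTop (𝓝 l) := by
  have h0 : Tendsto (fun p => q p - r p) primesAtTop (𝓝 0) :=
    squeeze_zero_norm h ((tendsto_const_div_atTop_nhds_zero_nat K).comp
      tendsto_natCast_primesAtTop)
  simpa using h0.add hr

lemma tendsto_choose_div_pow (d : ℕ) :
    Tendsto (fun p : Nat.Primes => ((p : ℕ).choose d : ℝ) / ((p : ℕ) : ℝ) ^ d) primesAtTop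
      (𝓝 (1 / (d.factorial : ℝ))) := by
  have h : Tendsto (fun n : ℕ => (n.choose d : ℝ) / (n : ℝ) ^ d) atTop
      (𝓝 (1 / (d.factorial : ℝ))) := by
    have h1 := (isEquivalent_choose d).div
      (Asymptotics.IsEquivalent.refl (u := fun n : ℕ => (n : ℝ) ^ d) (l := atTop))
    refine (h1.tendsto_nhds_iff).2 ?_
    refine tendsto_const_nhds.congr' ?_
    filter_upwards [eventually_gt_atTop 0] with n hn
    have : (n : ℝ) ^ d ≠ 0 := by positivity
    simp only [Pi.div_apply]
    field_simp
  exact h.comp tendsto_natCast_primesAtTop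

lemma tendsto_integral_rootWeight_monic {n d : ℕ} (hd : d ≤ n) :
    Tendsto (fun p : Nat.Primes => ∫ b, rootWeight d (X ^ n + redHom p n n b) ∂haarZpPow p n)
      primesAtTop (𝓝 (1 / (d.factorial : ℝ))) :=
  tendsto_of_abs_sub_le (fun _ => abs_integral_rootWeight_monic_sub_le hd)
    (tendsto_choose_div_pow d)

lemma tendsto_integral_rootWeight_general {n d : ℕ} (hd : d ≤ n) :
    Tendsto (fun p : Nat.Primes =>
      ∫ b, rootWeight d (0 + redHom p (n + 1) (n + 1) b) ∂haarZpPow p (n + 1))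
      primesAtTop (𝓝 (1 / (d.factorial : ℝ))) :=
  tendsto_of_abs_sub_le
    (fun _ => abs_integral_rootWeight_redHom_sub_le le_rfl (Nat.lt_succ_of_le hd))
    (tendsto_choose_div_pow d)

lemma tendsto_integral_rootWeight_ite {n d : ℕ} (hd : d ≤ n) :
    Tendsto (fun p : Nat.Primes =>
      ∫ b, rootWeight d ((if min (d + 1) n = n then X ^ n else 0) +
        redHom p n (min (d + 1) n) b) ∂haarZpPow p n)
      primesAtTop (𝓝 (1 / (d.factorial : ℝ))) :=
  tendsto_of_abs_sub_le (fun _ => abs_integral_rootWeight_ite_sub_le hd)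
    (tendsto_choose_div_pow d)

lemma tendsto_alphaStar (n r : ℕ) :
    Tendsto (fun p : Nat.Primes => alphaStar p n r) primesAtTop
      (𝓝 (∑ d ∈ Finset.range (n + 1),
        (-1 : ℝ) ^ ((d : ℤ) - (r : ℤ)) * (d.choose r : ℝ) * (1 / (d.factorial : ℝ)))) := by
  refine tendsto_of_abs_sub_le (fun _ => abs_alphaStar_sub_le n r) ?_
  simp_rw [fun p : Nat.Primes => integral_exactWeight_eq_sum (p := p) (r := r) (A := X ^ n)
    (fun b => (natDegree_X_pow_add_redHom b).le)]
  exact tendsto_finsetSum _ fun d hd => (tendsto_integral_rootWeight_monic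
    (Nat.le_of_lt_succ (Finset.mem_range.1 hd))).const_mul _

lemma tendsto_rhoStar (n r : ℕ) :
    Tendsto (fun p : Nat.Primes => rhoStar p n r) primesAtTop
      (𝓝 (∑ d ∈ Finset.range (n + 1),
        (-1 : ℝ) ^ ((d : ℤ) - (r : ℤ)) * (d.choose r : ℝ) * (1 / (d.factorial : ℝ)))) := by
  refine tendsto_of_abs_sub_le (fun _ => abs_rhoStar_sub_le n r) ?_
  simp_rw [fun p : Nat.Primes => integral_exactWeight_eq_sum (p := p) (r := r) (A := 0)
    (natDegree_zero_add_redHom_le n)]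
  exact tendsto_finsetSum _ fun d hd => (tendsto_integral_rootWeight_general
    (Nat.le_of_lt_succ (Finset.mem_range.1 hd))).const_mul _

end PadicRoots

theorem proposition1p2 :
    -- (a)
    (∀ n d : ℕ, d ≤ n →
      Tendsto (fun p : Nat.Primes => PadicRoots.alpha p n d) PadicRoots.primesAtTop
        (𝓝 (1 / (d.factorial : ℝ))) ∧
      Tendsto (fun p : Nat.Primes => PadicRoots.rho p n d) PadicRoots.primesAtTop
        (𝓝 (1 / (d.factorial : ℝ))) ∧
      Tendsto (fun p : Nat.Primes =>
          ((p : ℕ) : ℝ) ^ ((min (d + 1) n).choose 2) * PadicRoots.beta p n d)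
        PadicRoots.primesAtTop (𝓝 (1 / (d.factorial : ℝ)))) ∧
    -- (b), for fixed n
    (∀ n r : ℕ, r ≤ n →
      Tendsto (fun p : Nat.Primes => PadicRoots.rhoStar p n r) PadicRoots.primesAtTop
        (𝓝 (∑ d ∈ Finset.range (n + 1),
          (-1 : ℝ) ^ ((d : ℤ) - (r : ℤ)) * (d.choose r : ℝ) * (1 / (d.factorial : ℝ)))) ∧
      Tendsto (fun p : Nat.Primes => PadicRoots.alphaStar p n r) PadicRoots.primesAtTop
        (𝓝 (∑ d ∈ Finset.range (n + 1),
          (-1 : ℝ) ^ ((d : ℤ) - (r : ℤ)) * (d.choose r : ℝ) * (1 / (d.factorial : ℝ)))) ∧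
      ∑ d ∈ Finset.range (n + 1),
          (-1 : ℝ) ^ ((d : ℤ) - (r : ℤ)) * (d.choose r : ℝ) * (1 / (d.factorial : ℝ)) =
        1 / (r.factorial : ℝ) *
          ∑ d ∈ Finset.range (n - r + 1), (-1 : ℝ) ^ d * (1 / (d.factorial : ℝ))) ∧
    -- (b), the iterated limits: first p → ∞, giving L n for every n ≥ r, then n → ∞
    (∀ r : ℕ,
      (∃ L : ℕ → ℝ,
        (∀ n : ℕ, r ≤ n →
          Tendsto (fun p : Nat.Primes => PadicRoots.rhoStar p n r) PadicRoots.primesAtTop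
            (𝓝 (L n))) ∧
        Tendsto L atTop (𝓝 (1 / (r.factorial : ℝ) * Real.exp (-1)))) ∧
      (∃ L : ℕ → ℝ,
        (∀ n : ℕ, r ≤ n →
          Tendsto (fun p : Nat.Primes => PadicRoots.alphaStar p n r) PadicRoots.primesAtTop
            (𝓝 (L n))) ∧
        Tendsto L atTop (𝓝 (1 / (r.factorial : ℝ) * Real.exp (-1))))) ∧
    -- (c)
    (∀ n r : ℕ, r ≤ n → r + 1 ≠ n →
      Tendsto (fun p : Nat.Primes =>
          ((p : ℕ) : ℝ) ^ ((min (r + 1) n).choose 2) * PadicRoots.betaStar p n r)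
        PadicRoots.primesAtTop (𝓝 (1 / (r.factorial : ℝ)))) := by
  refine ⟨fun n d hd => ⟨?_, ?_, ?_⟩, fun n r hr => ⟨?_, ?_, ?_⟩, fun r => ⟨?_, ?_⟩,
    fun n r hr hrn => ?_⟩
  · exact PadicRoots.tendsto_of_abs_sub_le (fun _ => PadicRoots.abs_alpha_sub_le)
      (PadicRoots.tendsto_integral_rootWeight_monic hd)
  · exact PadicRoots.tendsto_of_abs_sub_le (fun _ => PadicRoots.abs_rho_sub_le n d)
      (PadicRoots.tendsto_integral_rootWeight_general hd)
  · exact PadicRoots.tendsto_of_abs_sub_le (fun _ => PadicRoots.abs_pow_mul_beta_sub_le hd)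
      (PadicRoots.tendsto_integral_rootWeight_ite hd)
  · exact PadicRoots.tendsto_rhoStar n r
  · exact PadicRoots.tendsto_alphaStar n r
  · exact PadicRoots.sum_neg_one_zpow_choose_div_factorial hr
  -- The witness is the closed form; it agrees with the alternating sum for `r ≤ n`, and its values
  -- for `n < r` do not affect the limit.
  · refine ⟨_, fun n hr => ?_, PadicRoots.tendsto_sum_neg_one_pow_div_factorial r⟩
    rw [← PadicRoots.sum_neg_one_zpow_choose_div_factorial hr]
    exact PadicRoots.tendsto_rhoStar n r
  · refine ⟨_, fun n hr => ?_, PadicRoots.tendsto_sum_neg_one_pow_div_factorial r⟩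
    rw [← PadicRoots.sum_neg_one_zpow_choose_div_factorial hr]
    exact PadicRoots.tendsto_alphaStar n r
  · exact PadicRoots.tendsto_of_abs_sub_le
      (fun _ => PadicRoots.abs_pow_mul_betaStar_sub_le hr hrn)
      (PadicRoots.tendsto_integral_rootWeight_ite hr)
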